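/- **Lemma (Expanding a clear region across a gap).** *Setting.* Let $\mathcal E\subset\mathbb R^2$ be a simple polygon (a compact region without holes). A point $q$ is visible from $p$ if $[p,q]\subset\mathcal E$; $\mathcal V(p)$ is the set of points visible from $p$. Searchlights (agents) $k\in I$, $I$ finite, sit at points $p^{[k]}\in\mathcal E$; a schedule consists of continuous functions $\theta^{[k]}$ from a time interval $[0,T]$ to the circle. The ray of $k$ at time $t$ is the part in $\mathcal V(p^{[k]})$ of the half-line from $p^{[k]}$ in direction $\theta^{[k]}(t)$; points on some ray are illuminated. Two points are separable at time $t$ if every curve joining them whose points, the two given points excepted, lie in the interior of $\mathcal E$ contains an illuminated point. Contamination is the least relation such that: $x\in\mathcal E$ is contaminated at time $0$ if it is not illuminated then; $x\in\mathcal E$ is contaminated at time $t>0$ if there are $t'\in[0,t)$ and $y$ contaminated at $t'$, $y$ not illuminated at any time in $[t',t]$, with $x,y$ not separable at $t$. A region is clear if none of its points is contaminated. A gap is a segment $[q,q']$ with $q,q'\in\partial\mathcal E$ and $]q,q'[\,\subset\operatorname{int}\mathcal E$. A PTSS partition is a cover of $\mathcal E$ by compact, simply connected cells $P^{[k]}$,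 $k\in I$, with disjoint interiors, which are star-shaped polygons separated by gaps (two neighbouring cells meet in exactly one gap, and inside $\operatorname{int}\mathcal E$ each cell is bounded by its gaps), such that the dual graph (cells sharing a nonconstant curve are adjacent) is a tree, and for some root $\rho$ we have $\ker P^{[\rho]}\cap\partial\mathcal E\neq\emptyset$ and $P^{[j]}\cap P^{[k]}\cap\ker P^{[k]}\cap\partial\mathcal E\ne\emptyset$ whenever $j$ is the parent of $k$. In the PTSS tree (for such a root) the agents are placed at points $p^{[\rho]}$, $p^{[k]}$ of these sets. A sweep of the cell $P^{[k]}$ from $p^{[k]}$ consists of a start angle, a sense of rotation and a total angle $w_k\in(0,2\pi)$ such that the directions passed, both ends included, are exactly those in which points of $P^{[k]}\setminus\{p^{[k]}\}$ are seen from $p^{[k]}$. A sweep plan is a choice of a sweep for every cell such that each non-root agent starts aimed along the gap to its parent. After turning through the angle $\alpha$, agent $k$ has swept the set $S_k(\alpha)\subset P^{[k]}$ of points of its cell in the directions passed so far (together with $p^{[k]}$). A state, in which some agents are engaged and each engaged agent $k$ has turned through $\alpha_k\in[0,w_k]$ and is aimed accordingly, is coordinated if (a) an engaged parent has left the direction of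 some point ($\neq$ its own position) of the gap to a child behind only if the child is engaged; (b) an engaged agent $k$ with $\alpha_k>0$ is released: its parent $h$ (if any) is engaged and $P^{[h]}\cap P^{[k]}\subset S_h(\alpha_h)$, i.e. the parent has slewed over the whole gap. A schedule is a coordinated sweep on $[t_0,t_1]$ if all its states there are coordinated, engaged agents stay engaged and never turn back, and an agent becoming engaged after $t_0$ begins with $\alpha_k=0$ (at a first time of engagement). Let $W(t)$ denote the union of the $S_k(\alpha_k(t))$ over the agents engaged at time $t$, and $\partial_{\mathcal E}D=\overline D\cap\overline{\mathcal E\setminus D}$ for $D\subset \mathcal E$. *Statement.* Given a PTSS partition and tree of $\mathcal E$, let agent $i$ be the parent of agent $j$. Then a sweep plan exists, and for every sweep plan the following hold. 1. Let a schedule on $[0,t_1]$ be a coordinated sweep on $[t_0,t_1]$, $0\le t_0\le t_1$, and let $D\subset\mathcal E$ with $W(t_0)\subset D$ be clear at time $t_0$, each point of $\partial_{\mathcal E}D$ either lying in $W(t_0)$ or being illuminated throughout $[t_0,t_1]$. Then $D\cup W(t)$ is clear at every time $t\in[t_0,t_1]$. 2. Suppose that at time $t_0\geq 0$ of a schedule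 on $[0,t_0]$ the state is coordinated, $i$ is engaged and released, $j$ is not engaged, and $D\subset\mathcal E$ with $W(t_0)\subset D$ is clear, each point of $\partial_{\mathcal E}D$ either lying in $W(t_0)$ or being illuminated at $t_0$ by an agent other than $i$, $j$ and their children. Then there are times $t_0<t_1<t_2<t_3$ and a continuation of the schedule to $[0,t_3]$ which is a coordinated sweep on $[t_0,t_3]$, starting from the given state, such that: * during $[t_0,t_3]$ agents other than $i$, $j$ and their children do not move, and engaged agents other than $i,j$ do not turn; * during $[t_0,t_1]$ agent $i$ waits, not having begun to slew over the gap $P^{[i]}\cap P^{[j]}$, and by time $t_1$ agent $j$ is engaged; * during $[t_1,t_2]$ agent $j$ stays aimed across the gap, its ray containing the whole gap, with $\alpha_j=0$, and at time $t_2$ agent $i$ has slewed over the gap: $P^{[i]}\cap P^{[j]}\subset S_i(\alpha_i(t_2))$; * during $[t_2,t_3]$ both agents concurrently sweep the remainder of their cells: $\alpha_j$, and $\alpha_i$ unless $\alpha_i(t_2)=w_i$ already, are strictly increasing, and $\alpha_i(t_3)=w_i$, $\alpha_j(t_3)=w_j$; * $D\cup W(t)$ is clear at every time $t\in[t_0,t_3]$,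 and $D\cup P^{[i]}\cup P^{[j]}$ is clear at time $t_3$. -/

import Mathlib

open Set

noncomputable section

/-- The Euclidean plane. -/
abbrev Plane : Type := EuclideanSpace ℝ (Fin 2)

/-- The unit vector pointing in the direction of an angle of the circle. -/
def dir (θ : Real.Angle) : Plane := !₂[θ.cos, θ.sin]

/-! ### Environments and visibility -/

/-- A simple polygon as a region of the plane: compact, equal to the closure of its connected
interior, and bounded by a closed polygonal curve (cyclically indexed vertices `v`, edges
`[v i, v (i+1)]`) which does not intersect itself. -/
def IsSimplePolygon (E : Set Plane) : Prop :=
  IsCompact E ∧ closure (interior E) = E ∧ IsConnected (interior E) ∧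
  ∃ n : ℕ, 3 ≤ n ∧ ∃ v : ZMod n → Plane, Function.Injective v ∧
    (∀ i, segment ℝ (v i) (v (i + 1)) ∩ segment ℝ (v (i + 1)) (v (i + 1 + 1)) = {v (i + 1)}) ∧
    (∀ i j, i ≠ j → j ≠ i + 1 → i ≠ j + 1 →
      Disjoint (segment ℝ (v i) (v (i + 1))) (segment ℝ (v j) (v (j + 1)))) ∧
    frontier E = ⋃ i, segment ℝ (v i) (v (i + 1))

/-- The points of `E` visible from `p` in `E`. -/
def visibilitySet (E : Set Plane) (p : Plane) : Set Plane := {q | q ∈ E ∧ segment ℝ p q ⊆ E}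

/-- The kernel of a set: its points from which all its points are visible. -/
def starKernel (S : Set Plane) : Set Plane := {p | p ∈ S ∧ ∀ x ∈ S, segment ℝ p x ⊆ S}

/-- `[q, q']` is a gap of `E`. -/
def IsGap (E : Set Plane) (q q' : Plane) : Prop :=
  q ∈ frontier E ∧ q' ∈ frontier E ∧ openSegment ℝ q q' ⊆ interior E

/-! ### Searchlights, schedules and contamination -/

/-- The ray of a searchlight at `p` with configuration angle `θ`. -/
def lightRay (E : Set Plane) (p : Plane) (θ : Real.Angle) : Set Plane :=
  {x | x ∈ visibilitySet E p ∧ ∃ r : ℝ, 0 ≤ r ∧ x = p + r • dir θ}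

section Contamination

variable {ι : Type*} (E : Set Plane) (p : ι → Plane) (θ : ι → ℝ → Real.Angle)

/-- `x` is illuminated at time `t`. -/
def Illuminated (t : ℝ) (x : Plane) : Prop := ∃ k, x ∈ lightRay E (p k) (θ k t)

/-- `x` and `y` are separable at time `t`: every curve connecting them in the interior of `E`
contains an illuminated point. (The points `x`, `y` themselves may lie on the boundary.) -/
def Separable (t : ℝ) (x y : Plane) : Prop :=
  ∀ γ : Path x y, (∀ s, γ s ∈ interior E ∪ {x, y}) → ∃ s, Illuminated E p θ t (γ s)

/-- `Contaminated E p θ t x`: the point `x` of `E` is contaminated at time `t`. -/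
inductive Contaminated : ℝ → Plane → Prop
  | initial (x : Plane) (hx : x ∈ E) (h : ¬ Illuminated E p θ 0 x) : Contaminated 0 x
  | spread (t t' : ℝ) (x y : Plane) (hx : x ∈ E) (h0 : 0 ≤ t') (ht : t' < t)
      (hy : Contaminated t' y) (hdark : ∀ s ∈ Icc t' t, ¬ Illuminated E p θ s y)
      (hsep : ¬ Separable E p θ t x y) : Contaminated t x

/-- The region `R` is clear at time `t`. -/
def IsClear (t : ℝ) (R : Set Plane) : Prop := ∀ x ∈ R, ¬ Contaminated E p θ t x

end Contamination

/-! ### PTSS partitions and trees -/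

section PTSS

variable {ι : Type*}

/-- `P` is a partition of `E`. -/
structure IsPartition (E : Set Plane) (P : ι → Set Plane) : Prop where
  cover : ⋃ k, P k = E
  compact : ∀ k, IsCompact (P k)
  simplyConnected : ∀ k, SimplyConnectedSpace (P k)
  disjoint : ∀ k m, k ≠ m → Disjoint (interior (P k)) (interior (P m))

/-- The dual graph of a partition: two cells are adjacent if they share a nonconstant curve. -/
def dualGraph (P : ι → Set Plane) : SimpleGraph ι where
  Adj k m := k ≠ m ∧ ∃ x y, x ≠ y ∧ JoinedIn (P k ∩ P m) x y
  symm := ⟨fun k m h => by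
    obtain ⟨hne, x, y, hxy, hj⟩ := h
    exact ⟨hne.symm, x, y, hxy, by rwa [inter_comm]⟩⟩
  loopless := ⟨fun _ h => h.1 rfl⟩

/-- `j` is the parent of `k` in the dual graph rooted at `root`. -/
def IsParent (P : ι → Set Plane) (root j k : ι) : Prop :=
  (dualGraph P).Adj j k ∧ (dualGraph P).dist root k = (dualGraph P).dist root j + 1

/-- The cells are separated by gaps: they are polygonal regions, two neighbouring cells meet in a
gap, and inside `E` every cell is bounded by the gaps to its neighbours. -/
structure SeparatedByGaps (E : Set Plane) (P : ι → Set Plane) : Prop where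
  polygon : ∀ k, IsSimplePolygon (P k)
  gap : ∀ k m, (dualGraph P).Adj k m → ∃ v v', IsGap E v v' ∧ P k ∩ P m = segment ℝ v v'
  boundary : ∀ k, ∀ x ∈ frontier (P k) ∩ interior E, ∃ m, (dualGraph P).Adj k m ∧ x ∈ P m

/-- `root` is an admissible root of the dual graph. -/
def IsPTSSRoot (E : Set Plane) (P : ι → Set Plane) (root : ι) : Prop :=
  (starKernel (P root) ∩ frontier E).Nonempty ∧
  ∀ j k, IsParent P root j k → ((P j ∩ P k) ∩ starKernel (P k) ∩ frontier E).Nonempty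

/-- `P` is a PTSS partition of `E`. -/
structure IsPTSSPartition (E : Set Plane) (P : ι → Set Plane) : Prop where
  partition : IsPartition E P
  gaps : SeparatedByGaps E P
  starShaped : ∀ k, (starKernel (P k)).Nonempty
  tree : (dualGraph P).IsTree
  exists_root : ∃ root, IsPTSSRoot E P root

/-- The positions `p` are the nodes of a PTSS tree with the given root; its edges are those of the
dual graph. -/
structure IsPTSSTree (E : Set Plane) (P : ι → Set Plane) (root : ι) (p : ι → Plane) : Prop where
  isRoot : IsPTSSRoot E P root
  root_pos : p root ∈ starKernel (P root) ∩ frontier E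
  child_pos : ∀ j k, IsParent P root j k → p k ∈ (P j ∩ P k) ∩ starKernel (P k) ∩ frontier E

/-! ### Sweeping the cells -/

/-- The data for sweeping a cell once: a start angle, a sense of rotation (`1` or `-1`), and the
total angle to be turned through. -/
structure Sweep where
  start : ℝ
  orient : ℝ
  width : ℝ

/-- The configuration angle after turning through the angle `s` from the start. -/
def Sweep.angle (S : Sweep) (s : ℝ) : Real.Angle := ((S.start + S.orient * s : ℝ) : Real.Angle)

/-- `S` sweeps the cell `Q` from the point `c`: the directions in which points of `Q` are seen
from `c` are exactly those passed by `S`. -/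
def Sweep.Covers (S : Sweep) (c : Plane) (Q : Set Plane) : Prop :=
  (S.orient = 1 ∨ S.orient = -1) ∧ 0 < S.width ∧ S.width < 2 * Real.pi ∧
  (∀ x ∈ Q, x ≠ c → ∃ s ∈ Icc 0 S.width, ∃ r : ℝ, 0 < r ∧ x = c + r • dir (S.angle s)) ∧
  (∀ s ∈ Icc 0 S.width, ∃ r : ℝ, 0 < r ∧ c + r • dir (S.angle s) ∈ Q)

/-- The part of the cell `Q` swept from `c` after turning through the angle `a`. -/
def Sweep.swept (S : Sweep) (c : Plane) (Q : Set Plane) (a : ℝ) : Set Plane :=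
  {x | x ∈ Q ∧ ∃ s ∈ Icc 0 a, ∃ r : ℝ, 0 ≤ r ∧ x = c + r • dir (S.angle s)}

/-- After turning through the angle `a`, the searchlight at `c` has begun to slew over `G`:
it has left the direction of some point of `G` behind. -/
def Sweep.Begun (S : Sweep) (c : Plane) (G : Set Plane) (a : ℝ) : Prop :=
  ∃ s, 0 ≤ s ∧ s < a ∧ ∃ r : ℝ, 0 < r ∧ c + r • dir (S.angle s) ∈ G

variable (P : ι → Set Plane) (root : ι) (p : ι → Plane) (S : ι → Sweep)

/-- Every agent has a sweep of its own cell, and a child starts its sweep aimed across the gap to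
its parent. -/
def IsSweepPlan : Prop :=
  (∀ k, (S k).Covers (p k) (P k)) ∧
  ∀ j k, IsParent P root j k → ∀ x ∈ P j ∩ P k, ∃ r : ℝ, 0 ≤ r ∧ x = p k + r • dir ((S k).angle 0)

/-- The parent of `k`, if there is one, is engaged and has slewed over the whole gap to `k`. -/
def Released (on : ι → Prop) (a : ι → ℝ) (k : ι) : Prop :=
  ∀ j, IsParent P root j k → on j ∧ P j ∩ P k ⊆ (S j).swept (p j) (P j) (a j)

/-- Coordination at gaps. The agents `k` with `on k` are engaged and have turned through the angle
`a k`. A parent slews over the gap to a child only when the child is engaged, and a child leaves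
its start direction (across the gap) only after its parent has slewed over the gap. -/
structure Coordinated (on : ι → Prop) (a : ι → ℝ) : Prop where
  range : ∀ k, on k → a k ∈ Icc 0 (S k).width
  child_aimed : ∀ j k, IsParent P root j k → on j → (S j).Begun (p j) (P j ∩ P k) (a j) → on k
  child_waits : ∀ k, on k → 0 < a k → Released P root p S on a k

/-- The union of the parts of the cells swept by the engaged agents. -/
def sweptRegion (on : ι → Prop) (a : ι → ℝ) : Set Plane :=
  {x | ∃ k, on k ∧ x ∈ (S k).swept (p k) (P k) (a k)}

/-- Between the times `t₀` and `t₁` the schedule `θ` is a coordinated sweep: agent `k` is engaged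
from time `τ k` on, and then has turned through the angle `a k t` of its sweep at time `t`, never
turning back. An agent that becomes engaged after time `t₀` begins at its start direction. -/
structure IsSweeping (t₀ t₁ : ℝ) (θ : ι → ℝ → Real.Angle) (τ : ι → ℝ) (a : ι → ℝ → ℝ) :
    Prop where
  aim : ∀ k, ∀ t ∈ Icc t₀ t₁, τ k ≤ t → θ k t = (S k).angle (a k t)
  mono : ∀ k, ∀ s ∈ Icc t₀ t₁, ∀ t ∈ Icc t₀ t₁, τ k ≤ s → s ≤ t → a k s ≤ a k t
  begin_at_start : ∀ k, t₀ < τ k → τ k ≤ t₁ → a k (τ k) = 0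
  coordinated : ∀ t ∈ Icc t₀ t₁, Coordinated P root p S (fun k => τ k ≤ t) (fun k => a k t)

end PTSS

/-- The boundary of `D` relative to `E`. -/
def relBoundary (E D : Set Plane) : Set Plane := closure D ∩ closure (E \ D)

end

/-! The heart of the matter is that in a coordinated state the boundary of the swept region consists
of light. Suppose that a dark point `z` lies on the boundary of `D ∪ W` relative to `E`. Then `z`
lies in `W`, and an engaged agent that has swept `z` must have turned strictly past it. This passes
between neighbouring cells that share `z`. From parent to child: a parent that has left a gap point
behind has an engaged child, which aimed along the gap at its start. From child to parent: as the
gap point is dark, the child has left its start direction, so the parent has slewed over the gap.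
Inside a simple polygon small neighbourhoods of `z` stay connected when `z` is removed, so the cells
at `z` are linked by gaps through `z` (`IsPTSSPartition.mem_of_adj_closed`). Hence all of `E` near
`z` is swept, and `z` is no boundary point (`relBoundary_union_sweptRegion_subset`).

Clearness follows by induction on contamination (`IsSweeping.isClear_union`). A source `y` that
stays dark cannot be swept meanwhile, because a continuously turning ray would have hit it. So `y`
stays outside the region, and every admissible curve from the region to `y` crosses its boundary,
which is lit.

Sweep plans exist because a cell is a sector near its agent and the gap to the parent runs along an
edge of that sector (`IsPTSSTree.exists_sweep`). The expansion across a gap is the general result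
applied to an explicit schedule with three phases of unit length. -/

noncomputable section

open Topology Filter

/-! ### Polar coordinates in the plane -/

lemma norm_dir (θ : Real.Angle) : ‖dir θ‖ = 1 := by
  simp [dir, EuclideanSpace.norm_eq, Fin.sum_univ_two]

lemma continuous_dir : Continuous dir := by
  unfold dir
  refine (PiLp.continuous_toLp 2 _).comp (continuous_pi fun i => ?_)
  fin_cases i
  · exact Real.Angle.continuous_cos
  · exact Real.Angle.continuous_sin

lemma dir_injective : Function.Injective dir := by
  intro θ ψ h
  have h0 := congrArg (fun x : Plane => x 0) h
  have h1 := congrArg (fun x : Plane => x 1) h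
  induction θ using Real.Angle.induction_on
  induction ψ using Real.Angle.induction_on
  simp only [dir, Real.Angle.cos_coe, Real.Angle.sin_coe] at h0 h1
  exact Real.Angle.cos_sin_inj h0 h1

lemma smul_dir_inj {r r' : ℝ} (hr : 0 < r) (hr' : 0 < r') {θ θ' : Real.Angle}
    (h : r • dir θ = r' • dir θ') : r = r' ∧ θ = θ' := by
  have hn := congrArg norm h
  rw [norm_smul, norm_smul, norm_dir, norm_dir, Real.norm_of_nonneg hr.le,
    Real.norm_of_nonneg hr'.le, mul_one, mul_one] at hn
  subst hn
  exact ⟨rfl, dir_injective (smul_right_injective _ hr.ne' h)⟩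

lemma exists_eq_norm_smul_dir (x : Plane) : ∃ θ : ℝ, x = ‖x‖ • dir θ := by
  set z : ℂ := ⟨x 0, x 1⟩
  have hz : ‖x‖ = ‖z‖ := by
    rw [EuclideanSpace.norm_eq, Complex.norm_def, Complex.normSq_apply]
    simp [Fin.sum_univ_two, z, sq]
  refine ⟨z.arg, ?_⟩
  rw [hz]
  ext i
  fin_cases i
  · simp [dir, z]
  · simp [dir, z]

/-- The window of angles may start anywhere, so directions can be normalised relative to an edge of
a sector. -/
lemma exists_polar {c x : Plane} (hx : x ≠ c) (α : ℝ) :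
    ∃ r : ℝ, 0 < r ∧ ∃ φ ∈ Ico α (α + 2 * Real.pi), x = c + r • dir φ := by
  obtain ⟨θ, hθ⟩ := exists_eq_norm_smul_dir (x - c)
  refine ⟨‖x - c‖, norm_pos_iff.2 (sub_ne_zero.2 hx), toIcoMod Real.two_pi_pos α θ,
    toIcoMod_mem_Ico _ _ _, ?_⟩
  rw [Real.Angle.coe_toIcoMod, ← hθ]
  simp

lemma dist_add_smul_dir (c : Plane) {r : ℝ} (hr : 0 ≤ r) (θ : Real.Angle) :
    dist (c + r • dir θ) c = r := by
  rw [dist_eq_norm, add_sub_cancel_left, norm_smul, norm_dir, Real.norm_of_nonneg hr, mul_one]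

lemma add_smul_dir_ne (c : Plane) {r : ℝ} (hr : 0 < r) (θ : Real.Angle) : c + r • dir θ ≠ c := by
  intro h
  have := dist_add_smul_dir c hr.le θ
  rw [h, dist_self] at this
  exact hr.ne this

lemma eq_of_coe_eq_of_abs_sub_lt {a b : ℝ} (h : (a : Real.Angle) = b)
    (hab : |a - b| < 2 * Real.pi) : a = b := by
  obtain ⟨k, hk⟩ := Real.Angle.angle_eq_iff_two_pi_dvd_sub.1 h
  have hk0 : k = 0 := by
    rw [hk, abs_mul, abs_of_pos Real.two_pi_pos] at hab
    have h1 : |(k : ℝ)| < 1 := by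
      by_contra hc
      push Not at hc
      nlinarith [Real.pi_pos]
    exact Int.abs_lt_one_iff.1 (by exact_mod_cast h1)
  rw [hk0] at hk
  simp at hk
  linarith

lemma coe_add_two_pi (a : ℝ) : ((a + 2 * Real.pi : ℝ) : Real.Angle) = a := by
  rw [Real.Angle.coe_add, Real.Angle.coe_two_pi, add_zero]

lemma mem_segment_add_smul_dir {c x : Plane} {ρ : ℝ} (hρ : 0 < ρ) {θ : Real.Angle} :
    x ∈ segment ℝ c (c + ρ • dir θ) ↔ ∃ r ∈ Icc 0 ρ, x = c + r • dir θ := by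
  rw [segment_eq_image']
  constructor
  · rintro ⟨s, ⟨h0, h1⟩, rfl⟩
    refine ⟨s * ρ, ⟨by positivity, by nlinarith⟩, ?_⟩
    simp [smul_smul]
  · rintro ⟨r, ⟨h0, h1⟩, rfl⟩
    refine ⟨r / ρ, ⟨by positivity, (div_le_one hρ).2 h1⟩, ?_⟩
    simp [smul_smul, div_mul_cancel₀ _ hρ.ne']

lemma isClosed_segment (a b : Plane) : IsClosed (segment ℝ a b) := by
  rw [segment_eq_image']
  exact (isCompact_Icc.image (by fun_prop)).isClosed

/-- The open sector at `c` of radius `δ` between the angles `α` and `β`, without its apex. -/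
def openSector (c : Plane) (δ α β : ℝ) : Set Plane :=
  {x | ∃ r ∈ Ioo 0 δ, ∃ φ ∈ Ioo α β, x = c + r • dir (φ : ℝ)}

lemma isPreconnected_openSector (c : Plane) (δ α β : ℝ) :
    IsPreconnected (openSector c δ α β) := by
  have hf : Continuous fun q : ℝ × ℝ => c + q.1 • dir (q.2 : ℝ) :=
    continuous_const.add (continuous_fst.smul
      (continuous_dir.comp (Real.Angle.continuous_coe.comp continuous_snd)))
  convert (isPreconnected_Ioo (a := (0 : ℝ)) (b := δ)).prod
    (isPreconnected_Ioo (a := α) (b := β)) |>.image _ hf.continuousOn using 1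
  ext x
  constructor
  · rintro ⟨r, hr, φ, hφ, rfl⟩
    exact ⟨(r, φ), ⟨hr, hφ⟩, rfl⟩
  · rintro ⟨⟨r, φ⟩, ⟨hr, hφ⟩, rfl⟩
    exact ⟨r, hr, φ, hφ, rfl⟩

lemma openSector_subset_ball (c : Plane) (δ α β : ℝ) :
    openSector c δ α β ⊆ Metric.ball c δ := by
  rintro x ⟨r, hr, φ, -, rfl⟩
  rw [Metric.mem_ball, dist_add_smul_dir c hr.1.le]
  exact hr.2

lemma notMem_openSector_self (c : Plane) (δ α β : ℝ) : c ∉ openSector c δ α β := by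
  rintro ⟨r, hr, φ, -, h⟩
  exact add_smul_dir_ne c hr.1 _ h.symm

/-! ### Simple polygons near a boundary point -/

/-- Off the frontier, the plane splits into two disjoint open sets: the interior and the complement
of the closure. -/
lemma IsPreconnected.subset_interior_or_disjoint {s t : Set Plane} (hs : IsPreconnected s)
    (h : Disjoint s (frontier t)) : s ⊆ interior t ∨ Disjoint s t := by
  have hsub : s ⊆ interior t ∪ (closure t)ᶜ := by
    intro x hx
    by_contra hc
    simp only [mem_union, mem_compl_iff, not_or, not_not] at hc
    exact disjoint_left.1 h hx ⟨hc.2, hc.1⟩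
  rcases hs.subset_or_subset isOpen_interior isClosed_closure.isOpen_compl
    (disjoint_compl_right.mono_left (interior_subset.trans subset_closure)) hsub with h1 | h1
  · exact Or.inl h1
  · exact Or.inr (disjoint_left.2 fun x hx hxt => h1 hx (subset_closure hxt))

/-- Near a boundary point, the boundary of a simple polygon consists of two segments. -/
lemma IsSimplePolygon.exists_frontier_eq {E : Set Plane} (hE : IsSimplePolygon E) {z : Plane}
    (hz : z ∈ frontier E) : ∃ q q' : Plane, q ≠ z ∧ q' ≠ z ∧
      segment ℝ z q ∩ segment ℝ z q' ⊆ {z} ∧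
      ∀ᶠ x in 𝓝 z, x ∈ frontier E ↔ x ∈ segment ℝ z q ∪ segment ℝ z q' := by
  obtain ⟨-, -, -, n, hn, v, hv, hadj, hdisj, hfr⟩ := hE
  have : NeZero n := ⟨by omega⟩
  have : Fact (1 < n) := ⟨by omega⟩
  have h1 : (1 : ZMod n) ≠ 0 := one_ne_zero
  have h2 : (1 + 1 : ZMod n) ≠ 0 := by
    have : ((2 : ℕ) : ZMod n) ≠ 0 := by
      rw [Ne, ZMod.natCast_eq_zero_iff]
      intro h
      have := Nat.le_of_dvd (by norm_num) h
      omega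
    intro h
    apply this
    push_cast
    rw [← h]
    norm_num
  -- There are finitely many closed edges, so those that miss `z` miss a neighbourhood of it.
  have hloc : ∀ᶠ x in 𝓝 z, ∀ i, x ∈ segment ℝ (v i) (v (i + 1)) →
      z ∈ segment ℝ (v i) (v (i + 1)) := by
    refine eventually_all.2 fun i => ?_
    by_cases hi : z ∈ segment ℝ (v i) (v (i + 1))
    · exact Eventually.of_forall fun _ _ => hi
    · filter_upwards [(isClosed_segment _ _).isOpen_compl.mem_nhds hi] with x hx hx'
      exact absurd hx' hx
  have key : ∀ m, z = v (m + 1) → ∃ q q' : Plane, q ≠ z ∧ q' ≠ z ∧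
      segment ℝ z q ∩ segment ℝ z q' ⊆ {z} ∧
      ∀ᶠ x in 𝓝 z, x ∈ frontier E ↔ x ∈ segment ℝ z q ∪ segment ℝ z q' := by
    rintro m rfl
    refine ⟨v m, v (m + 1 + 1), fun h => h1 ?_, fun h => h1 ?_, ?_, ?_⟩
    · simpa using (hv h).symm
    · simpa using hv h
    · rw [segment_symm, hadj m]
    · filter_upwards [hloc] with x hx
      rw [hfr, mem_iUnion, segment_symm ℝ (v (m + 1)) (v m)]
      constructor
      · rintro ⟨i, hi⟩
        have hzi := hx i hi
        by_cases him : i = m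
        · subst him; exact Or.inl hi
        by_cases him1 : i = m + 1
        · subst him1; exact Or.inr hi
        exfalso
        by_cases hmi : m = i + 1
        · subst hmi
          have : v (i + 1 + 1) ∈ ({v (i + 1)} : Set Plane) := by
            rw [← hadj i]
            exact ⟨hzi, right_mem_segment _ _ _⟩
          exact h1 (by simpa using hv this)
        · exact disjoint_left.1 (hdisj i m him hmi him1) hzi (right_mem_segment _ _ _)
      · rintro (h | h)
        exacts [⟨m, h⟩, ⟨m + 1, h⟩]
  have hz' := hz
  rw [hfr, mem_iUnion] at hz'
  obtain ⟨i, hi⟩ := hz'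
  by_cases hzi : z = v i
  · exact key (i - 1) (by simpa using hzi)
  by_cases hzi1 : z = v (i + 1)
  · exact key i hzi1
  have huniq : ∀ j, z ∈ segment ℝ (v j) (v (j + 1)) → j = i := by
    intro j hj
    by_contra hji
    by_cases ha : i = j + 1
    · subst ha
      have : z ∈ ({v (j + 1)} : Set Plane) := by rw [← hadj j]; exact ⟨hj, hi⟩
      exact hzi this
    by_cases hb : j = i + 1
    · subst hb
      have : z ∈ ({v (i + 1)} : Set Plane) := by rw [← hadj i]; exact ⟨hi, hj⟩
      exact hzi1 this
    · exact disjoint_left.1 (hdisj j i hji ha hb) hj hi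
  -- Here `z` is interior to its edge, which it cuts into the two required segments.
  have hun : segment ℝ (v i) (v (i + 1)) = segment ℝ z (v i) ∪ segment ℝ z (v (i + 1)) := by
    refine Subset.antisymm (fun x hx => ?_) (union_subset
      ((convex_segment _ _).segment_subset hi (left_mem_segment _ _ _))
      ((convex_segment _ _).segment_subset hi (right_mem_segment _ _ _)))
    have hor : Wbtw ℝ (v i) x z ∨ Wbtw ℝ (v i) z x := by
      have hi' := hi
      have hx' := hx
      rw [segment_eq_image'] at hi' hx'
      obtain ⟨s, hs, rfl⟩ := hi'
      obtain ⟨t, ht, rfl⟩ := hx'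
      have := wbtw_or_wbtw_smul_vadd_of_nonneg (v i) (v (i + 1) - v i) ht.1 hs.1
      simpa [add_comm] using this
    rcases hor with h | h
    · left
      rw [segment_symm]
      exact mem_segment_iff_wbtw.2 h
    · right
      exact mem_segment_iff_wbtw.2 ((mem_segment_iff_wbtw.1 hx).trans_left_right h)
  refine ⟨v i, v (i + 1), Ne.symm hzi, Ne.symm hzi1, ?_, ?_⟩
  · rintro x ⟨hxa, hxb⟩
    have h1 := (mem_segment_iff_wbtw.1 hi).trans_right_left (mem_segment_iff_wbtw.1 hxb)
    have h2 := wbtw_comm.1 (mem_segment_iff_wbtw.1 hxa)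
    exact (h1.swap_right_iff.1 h2).symm
  · filter_upwards [hloc] with x hx
    rw [hfr, mem_iUnion, ← hun]
    exact ⟨fun ⟨j, hj⟩ => huniq j (hx j hj) ▸ hj, fun h => ⟨i, h⟩⟩

/-- Within the distance `δ` of `c`, the region `Q` is the sector between the angles `α` and `β`. -/
structure IsLocalSector (Q : Set Plane) (c : Plane) (δ α β : ℝ) : Prop where
  lt : α < β
  lt_add : β < α + 2 * Real.pi
  pos : 0 < δ
  inner : ∀ r ∈ Ioo 0 δ, ∀ φ ∈ Ioo α β, c + r • dir (φ : ℝ) ∈ interior Q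
  left : ∀ r ∈ Ioo 0 δ, c + r • dir (α : ℝ) ∈ frontier Q
  right : ∀ r ∈ Ioo 0 δ, c + r • dir (β : ℝ) ∈ frontier Q
  outer : ∀ r ∈ Ioo 0 δ, ∀ φ ∈ Ioo β (α + 2 * Real.pi), c + r • dir (φ : ℝ) ∉ Q

lemma IsSimplePolygon.isClosed {Q : Set Plane} (hQ : IsSimplePolygon Q) : IsClosed Q :=
  hQ.1.isClosed

lemma exists_mem_ball_polar {c x : Plane} {δ α β : ℝ} (hx : x ∈ Metric.ball c δ)
    (hxc : x ≠ c) :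
    ∃ r ∈ Ioo 0 δ, ∃ φ : ℝ, x = c + r • dir φ ∧
      (φ = α ∨ φ ∈ Ioo α β ∨ φ = β ∨ φ ∈ Ioo β (α + 2 * Real.pi)) := by
  obtain ⟨r, hr, φ, hφ, rfl⟩ := exists_polar hxc α
  rw [Metric.mem_ball, dist_add_smul_dir c hr.le] at hx
  refine ⟨r, ⟨hr, hx⟩, φ, rfl, ?_⟩
  rcases hφ.1.eq_or_lt with h | h
  · exact Or.inl h.symm
  rcases lt_trichotomy φ β with h' | h' | h'
  · exact Or.inr (Or.inl ⟨h, h'⟩)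
  · exact Or.inr (Or.inr (Or.inl h'))
  · exact Or.inr (Or.inr (Or.inr ⟨h', hφ.2⟩))

lemma IsSimplePolygon.exists_isLocalSector {Q : Set Plane} (hQ : IsSimplePolygon Q) {c : Plane}
    (hc : c ∈ frontier Q) : ∃ δ α β : ℝ, IsLocalSector Q c δ α β := by
  obtain ⟨q, q', hq, hq', hqq', hev⟩ := hQ.exists_frontier_eq hc
  obtain ⟨ε, hε, hball⟩ := Metric.eventually_nhds_iff_ball.1 hev
  obtain ⟨ρ, hρ, α, -, rfl⟩ := exists_polar hq 0
  obtain ⟨ρ', hρ', β, hβ, rfl⟩ := exists_polar hq' α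
  have hαβ : α < β := by
    refine hβ.1.lt_of_ne ?_
    rintro rfl
    have hm : 0 < min ρ ρ' := lt_min hρ hρ'
    have : c + min ρ ρ' • dir (α : ℝ) ∈ ({c} : Set Plane) := hqq'
      ⟨(mem_segment_add_smul_dir hρ).2 ⟨_, ⟨hm.le, min_le_left _ _⟩, rfl⟩,
        (mem_segment_add_smul_dir hρ').2 ⟨_, ⟨hm.le, min_le_right _ _⟩, rfl⟩⟩
    exact add_smul_dir_ne c hm _ this
  set δ := min ε (min ρ ρ')
  have hδ : 0 < δ := lt_min hε (lt_min hρ hρ')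
  have hδε : δ ≤ ε := min_le_left _ _
  have hδρ : δ ≤ ρ := (min_le_right _ _).trans (min_le_left _ _)
  have hδρ' : δ ≤ ρ' := (min_le_right _ _).trans (min_le_right _ _)
  have hfr : ∀ r ∈ Ioo 0 δ, ∀ φ : ℝ, c + r • dir (φ : ℝ) ∈ frontier Q ↔
      (φ : Real.Angle) = α ∨ (φ : Real.Angle) = β := by
    intro r hr φ
    rw [hball _ (by
      rw [Metric.mem_ball, dist_add_smul_dir c hr.1.le]; exact hr.2.trans_le hδε), mem_union,
      mem_segment_add_smul_dir hρ, mem_segment_add_smul_dir hρ']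
    refine or_congr ?_ ?_
    · constructor
      · rintro ⟨s, hs, h⟩
        rw [add_right_inj] at h
        rcases hs.1.eq_or_lt with rfl | hs0
        · rw [zero_smul] at h
          exact absurd (by rw [h, add_zero]) (add_smul_dir_ne c hr.1 φ)
        · exact (smul_dir_inj hr.1 hs0 h).2
      · intro h
        exact ⟨r, ⟨hr.1.le, hr.2.le.trans hδρ⟩, by rw [h]⟩
    · constructor
      · rintro ⟨s, hs, h⟩
        rw [add_right_inj] at h
        rcases hs.1.eq_or_lt with rfl | hs0
        · rw [zero_smul] at h
          exact absurd (by rw [h, add_zero]) (add_smul_dir_ne c hr.1 φ)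
        · exact (smul_dir_inj hr.1 hs0 h).2
      · intro h
        exact ⟨r, ⟨hr.1.le, hr.2.le.trans hδρ'⟩, by rw [h]⟩
  have hπ := Real.pi_pos
  -- The two boundary segments cut the disc into two open sectors free of boundary points, so each
  -- lies inside `Q` or misses it.
  have hd1 : Disjoint (openSector c δ α β) (frontier Q) := by
    refine disjoint_left.2 ?_
    rintro x ⟨r, hr, φ, hφ, rfl⟩ hx
    rcases (hfr r hr φ).1 hx with h | h
    · exact hφ.1.ne' (eq_of_coe_eq_of_abs_sub_lt h (by
        rw [abs_lt]; constructor <;> linarith [hφ.1, hφ.2, hβ.2]))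
    · exact hφ.2.ne (eq_of_coe_eq_of_abs_sub_lt h (by
        rw [abs_lt]; constructor <;> linarith [hφ.1, hφ.2, hβ.2]))
  have hd2 : Disjoint (openSector c δ β (α + 2 * Real.pi)) (frontier Q) := by
    refine disjoint_left.2 ?_
    rintro x ⟨r, hr, φ, hφ, rfl⟩ hx
    rcases (hfr r hr φ).1 hx with h | h
    · exact hφ.2.ne (eq_of_coe_eq_of_abs_sub_lt (h.trans (coe_add_two_pi α).symm) (by
        rw [abs_lt]; constructor <;> linarith [hφ.1, hφ.2, hβ.2]))
    · exact hφ.1.ne' (eq_of_coe_eq_of_abs_sub_lt h (by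
        rw [abs_lt]; constructor <;> linarith [hφ.1, hφ.2, hβ.2]))
  have hcover : ∀ x ∈ Metric.ball c δ, x ∈ frontier Q ∨ x ∈ openSector c δ α β ∨
      x ∈ openSector c δ β (α + 2 * Real.pi) := by
    intro x hx
    by_cases hxc : x = c
    · exact Or.inl (hxc ▸ hc)
    obtain ⟨r, hr, φ, rfl, h | h | h | h⟩ :=
      exists_mem_ball_polar (α := α) (β := β) hx hxc
    · exact Or.inl ((hfr r hr φ).2 (Or.inl (by rw [h])))
    · exact Or.inr (Or.inl ⟨r, hr, φ, h, rfl⟩)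
    · exact Or.inl ((hfr r hr φ).2 (Or.inr (by rw [h])))
    · exact Or.inr (Or.inr ⟨r, hr, φ, h, rfl⟩)
  have hclosed := hQ.isClosed
  have hnear := Metric.ball_mem_nhds c hδ
  rcases (isPreconnected_openSector c δ α β).subset_interior_or_disjoint hd1 with h1 | h1 <;>
  rcases (isPreconnected_openSector c δ β (α + 2 * Real.pi)).subset_interior_or_disjoint hd2
    with h2 | h2
  · exfalso
    have : Metric.ball c δ ⊆ Q := fun x hx => by
      rcases hcover x hx with h | h | h
      exacts [hclosed.frontier_subset h, interior_subset (h1 h), interior_subset (h2 h)]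
    exact hc.2 (mem_interior_iff_mem_nhds.2 (mem_of_superset hnear this))
  · exact ⟨δ, α, β, hαβ, hβ.2, hδ, fun r hr φ hφ => h1 ⟨r, hr, φ, hφ, rfl⟩,
      fun r hr => (hfr r hr α).2 (Or.inl rfl), fun r hr => (hfr r hr β).2 (Or.inr rfl),
      fun r hr φ hφ => disjoint_left.1 h2 ⟨r, hr, φ, hφ, rfl⟩⟩
  -- The inside is the sector from `β` on to the next copy of `α`, so the edges exchange roles and
  -- the outer angles shift by a full turn.
  · refine ⟨δ, β, α + 2 * Real.pi, hβ.2, by linarith, hδ,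
      fun r hr φ hφ => h2 ⟨r, hr, φ, hφ, rfl⟩,
      fun r hr => (hfr r hr β).2 (Or.inr rfl),
      fun r hr => (hfr r hr _).2 (Or.inl (coe_add_two_pi α)),
      fun r hr φ hφ => disjoint_left.1 h1 ⟨r, hr, φ - 2 * Real.pi,
        ⟨by linarith [hφ.1], by linarith [hφ.2]⟩, ?_⟩⟩
    rw [← coe_add_two_pi (φ - 2 * Real.pi), sub_add_cancel]
  -- If both sectors were outside, `c` would not be a limit of interior points.
  · exfalso
    have hcl : c ∈ closure (interior Q) := by
      rw [hQ.2.1]; exact hclosed.frontier_subset hc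
    obtain ⟨x, hxb, hxQ⟩ := mem_closure_iff_nhds.1 hcl _ hnear
    rcases hcover x hxb with h | h | h
    · exact h.2 hxQ
    · exact disjoint_left.1 h1 h (interior_subset hxQ)
    · exact disjoint_left.1 h2 h (interior_subset hxQ)

/-- A simple polygon is locally connected at each of its points, even if the point is removed. -/
lemma IsSimplePolygon.exists_isPreconnected {E : Set Plane} (hE : IsSimplePolygon E) {z : Plane}
    (hz : z ∈ E) {ε : ℝ} (hε : 0 < ε) : ∃ V : Set Plane, IsPreconnected V ∧ V ⊆ interior E ∧
      V ⊆ Metric.ball z ε ∧ z ∉ V ∧ ∃ δ > 0, Metric.ball z δ ∩ interior E ⊆ V ∪ {z} := by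
  by_cases hzi : z ∈ interior E
  · obtain ⟨δ, hδ, hball⟩ := Metric.isOpen_iff.1 isOpen_interior z hzi
    have hm : 0 < min δ ε := lt_min hδ hε
    -- The open range starts below `0` so as to contain a half-open full turn: the sector is the
    -- whole punctured disc.
    refine ⟨openSector z (min δ ε) (-1) (2 * Real.pi), isPreconnected_openSector _ _ _ _,
      (openSector_subset_ball _ _ _ _).trans ((Metric.ball_subset_ball (min_le_left _ _)).trans
        hball), (openSector_subset_ball _ _ _ _).trans
        (Metric.ball_subset_ball (min_le_right _ _)), notMem_openSector_self _ _ _ _,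
      min δ ε, hm, ?_⟩
    rintro x ⟨hx, -⟩
    by_cases hxz : x = z
    · exact Or.inr hxz
    obtain ⟨r, hr, φ, hφ, rfl⟩ := exists_polar hxz 0
    rw [Metric.mem_ball, dist_add_smul_dir z hr.le] at hx
    exact Or.inl ⟨r, ⟨hr, hx⟩, φ, ⟨by linarith [hφ.1], by linarith [hφ.2]⟩, rfl⟩
  · obtain ⟨δ, α, β, h⟩ := hE.exists_isLocalSector (c := z) ⟨subset_closure hz, hzi⟩
    have hm : 0 < min δ ε := lt_min h.pos hε
    refine ⟨openSector z (min δ ε) α β, isPreconnected_openSector _ _ _ _, ?_,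
      (openSector_subset_ball _ _ _ _).trans
        (Metric.ball_subset_ball (min_le_right _ _)), notMem_openSector_self _ _ _ _,
      min δ ε, hm, ?_⟩
    · rintro x ⟨r, hr, φ, hφ, rfl⟩
      exact h.inner r ⟨hr.1, hr.2.trans_le (min_le_left _ _)⟩ φ hφ
    · rintro x ⟨hx, hxE⟩
      by_cases hxz : x = z
      · exact Or.inr hxz
      obtain ⟨r, hr, φ, rfl, hφ⟩ := exists_mem_ball_polar (α := α) (β := β) hx hxz
      have hr' : r ∈ Ioo 0 δ := ⟨hr.1, hr.2.trans_le (min_le_left _ _)⟩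
      rcases hφ with rfl | hφ | rfl | hφ
      · exact absurd hxE (h.left r hr').2
      · exact Or.inl ⟨r, hr, φ, hφ, rfl⟩
      · exact absurd hxE (h.right r hr').2
      · exact absurd (interior_subset hxE) (h.outer r hr' φ hφ)

/-! ### Cells at a common point -/

section Cells

variable {ι : Type*} {E : Set Plane} {P : ι → Set Plane}

lemma IsPTSSPartition.isSimplePolygon_cell (hP : IsPTSSPartition E P) (k : ι) :
    IsSimplePolygon (P k) := hP.gaps.polygon k

lemma IsPTSSPartition.cell_subset (hP : IsPTSSPartition E P) (k : ι) : P k ⊆ E :=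
  hP.partition.cover ▸ subset_iUnion P k

/-- Cells with a common point inside the region have it on their boundaries. -/
lemma IsPTSSPartition.mem_frontier_of_mem (hP : IsPTSSPartition E P) {k m : ι} (hkm : k ≠ m)
    {w : Plane} (hk : w ∈ P k) (hm : w ∈ P m) : w ∈ frontier (P k) := by
  refine ⟨subset_closure hk, fun hint => ?_⟩
  rw [← (hP.isSimplePolygon_cell m).2.1] at hm
  obtain ⟨x, hx, hx'⟩ := mem_closure_iff_nhds.1 hm _ (isOpen_interior.mem_nhds hint)
  exact disjoint_left.1 (hP.partition.disjoint k m hkm) hx hx'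

lemma dualGraph_adj_of_segment {k m : ι} (hkm : k ≠ m) {x y : Plane} (hxy : x ≠ y)
    (h : segment ℝ x y ⊆ P k ∩ P m) : (dualGraph P).Adj k m :=
  ⟨hkm, x, y, hxy, JoinedIn.of_segment_subset h⟩

/-- Every cell containing `z` is reached from any of them by crossing gaps that contain `z`. -/
lemma IsPTSSPartition.mem_of_adj_closed [Finite ι] (hE : IsSimplePolygon E)
    (hP : IsPTSSPartition E P) {z : Plane} {A : Set ι} (hA : ∃ k ∈ A, z ∈ P k)
    (hadj : ∀ k ∈ A, z ∈ P k → ∀ m, (dualGraph P).Adj k m → z ∈ P m → m ∈ A) {l : ι}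
    (hl : z ∈ P l) : l ∈ A := by
  by_contra hlA
  obtain ⟨k₀, hk₀, hzk₀⟩ := hA
  have hclosed : ∀ k, IsClosed (P k) := fun k => (hP.partition.compact k).isClosed
  have hloc : ∀ᶠ x in 𝓝 z, ∀ k, x ∈ P k → z ∈ P k := by
    refine eventually_all.2 fun k => ?_
    by_cases hk : z ∈ P k
    · exact Eventually.of_forall fun _ _ => hk
    · filter_upwards [(hclosed k).isOpen_compl.mem_nhds hk] with x hx hx'
      exact absurd hx' hx
  obtain ⟨ε, hε, hball⟩ := Metric.eventually_nhds_iff_ball.1 hloc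
  obtain ⟨V, hV, hVE, hVball, hzV, δ, hδ, hδV⟩ :=
    hE.exists_isPreconnected (hP.cell_subset _ hl) hε
  have hmeet : ∀ k, z ∈ P k → (V ∩ P k).Nonempty := by
    intro k hk
    have hk' := hk
    rw [← (hP.isSimplePolygon_cell k).2.1] at hk'
    obtain ⟨x, hx, hxk⟩ := mem_closure_iff_nhds.1 hk' _ (Metric.ball_mem_nhds z hδ)
    have hopen : IsOpen (Metric.ball z δ ∩ interior (P k)) :=
      Metric.isOpen_ball.inter isOpen_interior
    -- The set `V` omits `z`. If the approximating point is `z` itself, another interior point of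
    -- the cell nearby replaces it.
    by_cases hxz : x = z
    · have hnt : (𝓝[≠] z).NeBot := inferInstance
      have hmem : Metric.ball z δ ∩ interior (P k) ∈ 𝓝[≠] z :=
        mem_nhdsWithin_of_mem_nhds (hopen.mem_nhds ⟨Metric.mem_ball_self hδ, hxz ▸ hxk⟩)
      obtain ⟨y, hy, hyz⟩ := hnt.nonempty_of_mem (inter_mem hmem self_mem_nhdsWithin)
      exact ⟨y, (hδV ⟨hy.1, interior_mono (hP.cell_subset k) hy.2⟩).resolve_right hyz,
        interior_subset hy.2⟩
    · exact ⟨x, (hδV ⟨hx, interior_mono (hP.cell_subset k) hxk⟩).resolve_right hxz,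
        interior_subset hxk⟩
  have hcA : IsClosed (⋃ k ∈ A, P k) :=
    (Set.toFinite A).isClosed_biUnion fun k _ => hclosed k
  have hcB : IsClosed (⋃ k ∈ Aᶜ, P k) :=
    (Set.toFinite Aᶜ).isClosed_biUnion fun k _ => hclosed k
  have hcov : V ⊆ (⋃ k ∈ A, P k) ∪ ⋃ k ∈ Aᶜ, P k := by
    intro x hx
    have hxE := interior_subset (hVE hx)
    rw [← hP.partition.cover] at hxE
    obtain ⟨k, hk⟩ := mem_iUnion.1 hxE
    by_cases hkA : k ∈ A
    · exact Or.inl (mem_biUnion hkA hk)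
    · exact Or.inr (mem_biUnion hkA hk)
  -- Connectedness of `V` yields a point `w ≠ z` common to a cell in `A` and a cell outside it.
  obtain ⟨w, hwV, hwA, hwB⟩ := isPreconnected_closed_iff.1 hV _ _ hcA hcB hcov
    ((hmeet k₀ hzk₀).mono (inter_subset_inter_right _ fun x hx => mem_biUnion hk₀ hx))
    ((hmeet l hl).mono (inter_subset_inter_right _ fun x hx =>
      mem_biUnion (show l ∈ Aᶜ from hlA) hx))
  obtain ⟨k, hkA, hwk⟩ := mem_iUnion₂.1 hwA
  obtain ⟨m, hmA, hwm⟩ := mem_iUnion₂.1 hwB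
  have hkm : k ≠ m := fun h => hmA (h ▸ hkA)
  have hwz : w ≠ z := fun h => hzV (h ▸ hwV)
  have hz : ∀ k, w ∈ P k → z ∈ P k := hball w (hVball hwV)
  -- The gap of `P k` through `w` may lead to a third cell `k'`. Still, `k'` contains `z` as well,
  -- and convexity of the gap puts `[w, z]` into `P k`. Doing this for both cells makes them share a
  -- segment.
  have hseg : ∀ k m, k ≠ m → w ∈ P k → w ∈ P m → segment ℝ w z ⊆ P k := by
    intro k m hkm hwk hwm
    obtain ⟨k', hk', hwk'⟩ := hP.gaps.boundary k w
      ⟨hP.mem_frontier_of_mem hkm hwk hwm, hVE hwV⟩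
    obtain ⟨v, v', -, hv⟩ := hP.gaps.gap k k' hk'
    have hconv : segment ℝ w z ⊆ P k ∩ P k' := by
      rw [hv]
      exact (convex_segment v v').segment_subset (hv ▸ ⟨hwk, hwk'⟩)
        (hv ▸ ⟨hz k hwk, hz k' hwk'⟩)
    exact hconv.trans inter_subset_left
  exact hmA (hadj k hkA (hz k hwk) m (dualGraph_adj_of_segment hkm hwz (subset_inter
    (hseg k m hkm hwk hwm) (hseg m k hkm.symm hwm hwk))) (hz m hwm))

end Cells

/-! ### Parents in the dual tree -/

section Tree

variable {ι : Type*} {P : ι → Set Plane} {root : ι}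

/-- The parent is the first step of a shortest walk to the root. -/
lemma exists_isParent (hT : (dualGraph P).IsTree) {k : ι} (hk : k ≠ root) :
    ∃ j, IsParent P root j k := by
  obtain ⟨w, hw⟩ := hT.connected.exists_walk_length_eq_dist k root
  cases w with
  | nil => exact absurd rfl hk
  | @cons _ u _ h q =>
    refine ⟨u, h.symm, ?_⟩
    have h1 := SimpleGraph.dist_le q
    rw [SimpleGraph.Walk.length_cons, SimpleGraph.dist_comm] at hw
    rw [SimpleGraph.dist_comm] at h1
    rcases hT.dist_eq_dist_add_one_of_adj root h with h2 | h2 <;> omega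

/-- A shortest walk to the root through either parent is a path, and paths in a tree are unique. -/
lemma IsParent.unique (hT : (dualGraph P).IsTree) {j j' k : ι} (h : IsParent P root j k)
    (h' : IsParent P root j' k) : j = j' := by
  have key : ∀ m, IsParent P root m k → ∃ w : (dualGraph P).Walk k root, w.IsPath ∧ w.snd = m := by
    intro m hm
    obtain ⟨q, hq⟩ := hT.connected.exists_walk_length_eq_dist m root
    refine ⟨SimpleGraph.Walk.cons hm.1.symm q, ?_, by simp⟩
    refine SimpleGraph.Walk.isPath_of_length_eq_dist _ ?_
    rw [SimpleGraph.Walk.length_cons, hq, SimpleGraph.dist_comm, ← hm.2, SimpleGraph.dist_comm]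
  obtain ⟨w, hw, rfl⟩ := key j h
  obtain ⟨w', hw', rfl⟩ := key j' h'
  rw [(hT.existsUnique_path k root).unique hw hw']

lemma isParent_or_isParent (hT : (dualGraph P).IsTree) {k m : ι} (h : (dualGraph P).Adj k m) :
    IsParent P root k m ∨ IsParent P root m k := by
  rcases hT.dist_eq_dist_add_one_of_adj root h with h2 | h2
  · exact Or.inr ⟨h.symm, h2⟩
  · exact Or.inl ⟨h, h2⟩

lemma IsParent.ne {j k : ι} (h : IsParent P root j k) : j ≠ k := h.1.1

end Tree

/-! ### Sweeps -/

namespace Sweep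

variable {S : Sweep} {c : Plane} {Q : Set Plane}

lemma continuous_angle (S : Sweep) : Continuous S.angle :=
  Real.Angle.continuous_coe.comp (by fun_prop)

lemma Covers.injOn_angle (h : S.Covers c Q) : InjOn S.angle (Icc 0 S.width) := by
  intro s hs s' hs' hss
  have h2 := h.2.2.1
  unfold angle at hss
  have := eq_of_coe_eq_of_abs_sub_lt hss (by
    rcases h.1 with h1 | h1 <;> rw [h1, abs_lt] <;> constructor <;>
      linarith [hs.1, hs.2, hs'.1, hs'.2])
  rcases h.1 with h1 | h1 <;> rw [h1] at this <;> linarith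

lemma swept_mono (S : Sweep) (c : Plane) (Q : Set Plane) : Monotone (S.swept c Q) := by
  rintro a b hab x ⟨hx, s, hs, r, hr, h⟩
  exact ⟨hx, s, ⟨hs.1, hs.2.trans hab⟩, r, hr, h⟩

lemma Covers.exists_angle (h : S.Covers c Q) {x : Plane} (hx : x ∈ Q) :
    ∃ s ∈ Icc 0 S.width, ∃ r : ℝ, 0 ≤ r ∧ x = c + r • dir (S.angle s) := by
  by_cases hxc : x = c
  · exact ⟨0, ⟨le_rfl, h.2.1.le⟩, 0, le_rfl, by simp [hxc]⟩
  · obtain ⟨s, hs, r, hr, he⟩ := h.2.2.2.1 x hx hxc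
    exact ⟨s, hs, r, hr.le, he⟩

lemma Covers.swept_width (h : S.Covers c Q) : S.swept c Q S.width = Q :=
  Subset.antisymm (fun _ hx => hx.1) fun _ hx => ⟨hx, h.exists_angle hx⟩

/-- The part of a compact cell seen in a closed range of directions is closed. -/
lemma isClosed_setOf_angle_mem (S : Sweep) (c : Plane) (hQ : IsCompact Q) (a b : ℝ) :
    IsClosed {x | x ∈ Q ∧ ∃ s ∈ Icc a b, ∃ r : ℝ, 0 ≤ r ∧ x = c + r • dir (S.angle s)} := by
  -- Boundedness limits the radii, so the set is `Q` cut with the image of a compact rectangle of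
  -- polar coordinates.
  obtain ⟨M, hM⟩ := hQ.isBounded.subset_closedBall c
  have hf : Continuous fun q : ℝ × ℝ => c + q.1 • dir (S.angle q.2) :=
    continuous_const.add (continuous_fst.smul
      (continuous_dir.comp (S.continuous_angle.comp continuous_snd)))
  convert hQ.isClosed.inter
    (((isCompact_Icc (a := (0 : ℝ)) (b := M)).prod (isCompact_Icc (a := a) (b := b))).image
      hf).isClosed using 1
  ext x
  constructor
  · rintro ⟨hx, s, hs, r, hr, rfl⟩
    have := hM hx
    rw [Metric.mem_closedBall, dist_add_smul_dir c hr] at this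
    exact ⟨hx, (r, s), ⟨⟨hr, this⟩, hs⟩, rfl⟩
  · rintro ⟨hx, ⟨r, s⟩, ⟨hr, hs⟩, rfl⟩
    exact ⟨hx, s, hs, r, hr.1, rfl⟩

lemma isClosed_swept (S : Sweep) (c : Plane) (hQ : IsCompact Q) (a : ℝ) :
    IsClosed (S.swept c Q a) := isClosed_setOf_angle_mem S c hQ 0 a

/-- A point whose direction has been left behind has been left behind together with all nearby
points of the cell. -/
lemma Covers.eventually_mem_swept (h : S.Covers c Q) (hQ : IsCompact Q) {s a r : ℝ} (hs : 0 ≤ s)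
    (hsa : s < a) (ha : a ≤ S.width) (hr : 0 < r) :
    ∀ᶠ x in 𝓝 (c + r • dir (S.angle s)), x ∈ Q → x ∈ S.swept c Q a := by
  -- The part of the cell not yet passed, seen at angles in `[a, S.width]`, is closed and misses the
  -- point, by injectivity of the angle on a range shorter than a full turn.
  have hnot : c + r • dir (S.angle s) ∉
      {x | x ∈ Q ∧ ∃ s ∈ Icc a S.width, ∃ r : ℝ, 0 ≤ r ∧ x = c + r • dir (S.angle s)} := by
    rintro ⟨-, s', hs', r', hr', he⟩
    rw [add_right_inj] at he
    rcases hr'.eq_or_lt with rfl | hr0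
    · rw [zero_smul] at he
      exact add_smul_dir_ne c hr _ (by rw [he, add_zero])
    · have := h.injOn_angle ⟨hs, (hsa.trans_le ha).le⟩ ⟨hs.trans (hsa.le.trans hs'.1), hs'.2⟩
        (smul_dir_inj hr hr0 he).2
      linarith [hs'.1]
  filter_upwards [(isClosed_setOf_angle_mem S c hQ a S.width).isOpen_compl.mem_nhds hnot]
    with x hx hxQ
  obtain ⟨s', hs', r', hr', he⟩ := h.exists_angle hxQ
  refine ⟨hxQ, s', ⟨hs'.1, ?_⟩, r', hr', he⟩
  by_contra hlt
  exact hx ⟨hxQ, s', ⟨(not_le.1 hlt).le, hs'.2⟩, r', hr', he⟩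

/-- The angle turned through is a continuous function of time. -/
lemma Covers.continuousOn_of_angle (h : S.Covers c Q) {a : ℝ → ℝ} {θ : ℝ → Real.Angle}
    {T : Set ℝ} (hθ : ContinuousOn θ T) (ha : ∀ t ∈ T, a t ∈ Icc 0 S.width)
    (haim : ∀ t ∈ T, θ t = S.angle (a t)) : ContinuousOn a T := by
  let f : Icc 0 S.width → Real.Angle := fun s => S.angle s
  -- A continuous injection of a compact interval is an embedding, so continuity of the direction
  -- lifts to the angle turned through.
  have hf : IsClosedEmbedding f :=
    (S.continuous_angle.comp continuous_subtype_val).isClosedEmbedding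
      fun s s' hss => Subtype.ext (h.injOn_angle s.2 s'.2 hss)
  let g : T → Icc 0 S.width := fun t => ⟨a t, ha t t.2⟩
  have hg : Continuous g := by
    rw [hf.isInducing.continuous_iff]
    convert continuousOn_iff_continuous_domRestrict.1 hθ using 1
    ext t
    exact (haim t t.2).symm
  exact continuousOn_iff_continuous_domRestrict.2 (continuous_subtype_val.comp hg)

end Sweep

/-! ### Expanding a clear region -/

section Expansion

variable {ι : Type*} {E : Set Plane} {P : ι → Set Plane} {root : ι} {p : ι → Plane}
  {S : ι → Sweep}

lemma IsPTSSTree.pos_mem (hP : IsPTSSPartition E P) (hp : IsPTSSTree E P root p) (k : ι) :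
    p k ∈ starKernel (P k) ∩ frontier E := by
  by_cases hk : k = root
  · exact hk ▸ hp.root_pos
  · obtain ⟨j, hj⟩ := exists_isParent hP.tree hk
    have := hp.child_pos j k hj
    exact ⟨this.1.2, this.2⟩

/-- Since the agent sits in the kernel of its cell, nothing blocks its view there. -/
lemma mem_lightRay_of_mem_cell (hP : IsPTSSPartition E P) (hp : IsPTSSTree E P root p) {k : ι}
    {x : Plane} (hx : x ∈ P k) {r : ℝ} (hr : 0 ≤ r) {θ : Real.Angle}
    (he : x = p k + r • dir θ) : x ∈ lightRay E (p k) θ :=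
  ⟨⟨hP.cell_subset k hx, ((hp.pos_mem hP k).1.2 x hx).trans (hP.cell_subset k)⟩, r, hr, he⟩

lemma illuminated_pos (hP : IsPTSSPartition E P) (hp : IsPTSSTree E P root p) (k : ι)
    (θ : ι → ℝ → Real.Angle) (t : ℝ) : Illuminated E p θ t (p k) :=
  ⟨k, mem_lightRay_of_mem_cell hP hp (hp.pos_mem hP k).1.1 le_rfl (by simp)⟩

lemma isClosed_sweptRegion [Finite ι] (hP : IsPTSSPartition E P) (on : ι → Prop) (a : ι → ℝ) :
    IsClosed (sweptRegion P p S on a) := by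
  have : sweptRegion P p S on a = ⋃ k ∈ {k | on k}, (S k).swept (p k) (P k) (a k) := by
    ext x
    simp [sweptRegion]
  rw [this]
  exact (Set.toFinite _).isClosed_biUnion fun k _ =>
    (S k).isClosed_swept (p k) (hP.partition.compact k) (a k)

/-- In a coordinated state the boundary of the region swept so far, enlarged by a region bounded
by rays, is illuminated. -/
lemma relBoundary_union_sweptRegion_subset [Finite ι] (hE : IsSimplePolygon E)
    (hP : IsPTSSPartition E P) (hp : IsPTSSTree E P root p) (hS : IsSweepPlan P root p S)
    {on : ι → Prop} {a : ι → ℝ} (hco : Coordinated P root p S on a) {θ : ι → ℝ → Real.Angle}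
    {t : ℝ} (haim : ∀ k, on k → θ k t = (S k).angle (a k)) {D : Set Plane}
    (hD : relBoundary E D ⊆ sweptRegion P p S on a ∪ {x | Illuminated E p θ t x}) :
    relBoundary E (D ∪ sweptRegion P p S on a) ⊆ {x | Illuminated E p θ t x} := by
  rintro z ⟨hz, hz'⟩
  by_contra hdark
  have hdark' : ¬ Illuminated E p θ t z := hdark
  have hlit : ∀ k (r : ℝ), on k → z ∈ P k → 0 ≤ r → z ≠ p k + r • dir ((S k).angle (a k)) :=
    fun k r hk hzk hr he => hdark' ⟨k, by
      rw [haim k hk]; exact mem_lightRay_of_mem_cell hP hp hzk hr he⟩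
  have hpos : ∀ k, z ≠ p k := fun k he => hdark' (he ▸ illuminated_pos hP hp k θ t)
  have hzW : z ∈ sweptRegion P p S on a := by
    rw [closure_union, (isClosed_sweptRegion hP on a).closure_eq] at hz
    rcases hz with hz | hz
    · exact (hD ⟨hz, closure_mono (sdiff_subset_sdiff_right subset_union_left) hz'⟩).resolve_right
        hdark
    · exact hz
  have hswept : ∀ k, on k → z ∈ (S k).swept (p k) (P k) (a k) →
      ∃ s, 0 ≤ s ∧ s < a k ∧ ∃ r : ℝ, 0 < r ∧ z = p k + r • dir ((S k).angle s) := by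
    rintro k hk ⟨hzk, s, hs, r, hr, he⟩
    refine ⟨s, hs.1, hs.2.lt_of_ne ?_, r, hr.lt_of_ne ?_, he⟩
    · rintro rfl
      exact hlit k r hk hzk hr he
    · rintro rfl
      exact hpos k (by simpa using he)
  -- The property propagated across gaps is that the agent is engaged and has swept `z`; darkness
  -- makes the passage strict.
  have hall : ∀ l, z ∈ P l → l ∈ {k | on k ∧ z ∈ (S k).swept (p k) (P k) (a k)} := by
    intro l hl
    refine hP.mem_of_adj_closed hE ?_ ?_ hl
    · obtain ⟨k, hk, hzk⟩ := hzW
      exact ⟨k, ⟨hk, hzk⟩, hzk.1⟩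
    · rintro k ⟨hk, hks⟩ hzk m hkm hzm
      rcases isParent_or_isParent (root := root) hP.tree hkm with hpar | hpar
      -- From parent to child: the child has swept its start direction even if it has not turned
      -- yet.
      · obtain ⟨s, hs0, hsa, r, hr, he⟩ := hswept k hk hks
        have hm : on m := hco.child_aimed k m hpar hk
          ⟨s, hs0, hsa, r, hr, he ▸ ⟨hzk, hzm⟩⟩
        obtain ⟨r', hr', he'⟩ := hS.2 k m hpar z ⟨hzk, hzm⟩
        exact ⟨hm, hzm, 0, ⟨le_rfl, (hco.range m hm).1⟩, r', hr', he'⟩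
      -- From child to parent: a child still at its start would light `z`, so it has turned and its
      -- parent has slewed over the gap.
      · obtain ⟨r, hr, he⟩ := hS.2 m k hpar z ⟨hzm, hzk⟩
        have hak : 0 < a k := by
          refine (hco.range k hk).1.lt_of_ne fun h0 => ?_
          rw [h0] at he
          exact hlit k r hk hzk hr he
        obtain ⟨hm, hsub⟩ := hco.child_waits k hk hak m hpar
        exact ⟨hm, hsub ⟨hzm, hzk⟩⟩
  have hev : ∀ᶠ x in 𝓝 z, ∀ l, x ∈ P l → x ∈ sweptRegion P p S on a := by
    refine eventually_all.2 fun l => ?_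
    by_cases hl : z ∈ P l
    · obtain ⟨hon, hsw⟩ := hall l hl
      obtain ⟨s, hs0, hsa, r, hr, he⟩ := hswept l hon hsw
      have := (hS.1 l).eventually_mem_swept (hP.partition.compact l) hs0 hsa
        (hco.range l hon).2 hr
      rw [← he] at this
      filter_upwards [this] with x hx hxl
      exact ⟨l, hon, hx hxl⟩
    · filter_upwards [(hP.partition.compact l).isClosed.isOpen_compl.mem_nhds hl] with x hx hx'
      exact absurd hx' hx
  obtain ⟨x, hx, hxE, hxn⟩ := mem_closure_iff_nhds.1 hz' _ hev
  rw [← hP.partition.cover] at hxE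
  obtain ⟨l, hl⟩ := mem_iUnion.1 hxE
  exact hxn (Or.inr (hx l hl))

/-- The preimages of the two closures are closed, nonempty and cover the connected unit interval. -/
lemma Path.exists_mem_relBoundary {R : Set Plane} {x y : Plane} (γ : Path x y)
    (hγ : ∀ s, γ s ∈ E) (hx : x ∈ R) (hy : y ∉ R) : ∃ s, γ s ∈ relBoundary E R := by
  obtain ⟨s, -, hs⟩ := isPreconnected_closed_iff.1 (isPreconnected_univ (α := unitInterval))
    (γ ⁻¹' closure R) (γ ⁻¹' closure (E \ R)) (isClosed_closure.preimage γ.continuous)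
    (isClosed_closure.preimage γ.continuous)
    (fun s _ => by
      by_cases h : γ s ∈ R
      · exact Or.inl (subset_closure h)
      · exact Or.inr (subset_closure ⟨hγ s, h⟩))
    ⟨0, mem_univ _, by simpa using subset_closure hx⟩
    ⟨1, mem_univ _, by
      have : y ∈ E := by simpa using hγ 1
      simpa using subset_closure (show y ∈ E \ R from ⟨this, hy⟩)⟩
  exact ⟨s, hs⟩

lemma Contaminated.mem {θ : ι → ℝ → Real.Angle} {t : ℝ} {x : Plane}
    (h : Contaminated E p θ t x) : x ∈ E := by
  cases h <;> assumption

/-- A point swept between two times has been illuminated in between. -/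
lemma IsSweeping.exists_illuminated (hP : IsPTSSPartition E P) (hp : IsPTSSTree E P root p)
    (hS : IsSweepPlan P root p S) {t₀ t₁ : ℝ} {θ : ι → ℝ → Real.Angle} {τ : ι → ℝ}
    {a : ι → ℝ → ℝ} (hθ : ∀ k, ContinuousOn (θ k) (Icc t₀ t₁))
    (h : IsSweeping P root p S t₀ t₁ θ τ a) {t' t : ℝ} (h0 : t₀ ≤ t') (htt : t' ≤ t)
    (h1 : t ≤ t₁) {y : Plane}
    (hy : y ∈ sweptRegion P p S (fun k => τ k ≤ t) (fun k => a k t))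
    (hy' : y ∉ sweptRegion P p S (fun k => τ k ≤ t') (fun k => a k t')) :
    ∃ u ∈ Icc t' t, Illuminated E p θ u y := by
  obtain ⟨k, hk, hyk, s, hs, r, hr, he⟩ := hy
  -- The time `c` is one at which `k` is engaged and has not passed `y`: either `t'` or the time of
  -- engagement. The intermediate value theorem then gives a time when `k` aims at `y`.
  have key : ∀ c, t' ≤ c → c ≤ t → τ k ≤ c → a k c ≤ s → ∃ u ∈ Icc t' t,
      Illuminated E p θ u y := by
    intro c hc hct hτ hac
    have hsub : Icc c t ⊆ Icc t₀ t₁ := Icc_subset_Icc (h0.trans hc) h1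
    have hcont : ContinuousOn (a k) (Icc c t) :=
      (hS.1 k).continuousOn_of_angle ((hθ k).mono hsub)
        (fun u hu => (h.coordinated u (hsub hu)).range k (hτ.trans hu.1))
        (fun u hu => h.aim k u (hsub hu) (hτ.trans hu.1))
    obtain ⟨u, hu, hus⟩ := intermediate_value_Icc hct hcont ⟨hac, hs.2⟩
    refine ⟨u, ⟨hc.trans hu.1, hu.2⟩, k, ?_⟩
    rw [h.aim k u (hsub hu) (hτ.trans hu.1), hus]
    exact mem_lightRay_of_mem_cell hP hp hyk hr he
  by_cases hτ : τ k ≤ t'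
  · refine key t' le_rfl htt hτ (le_of_not_ge fun hle => hy' ?_)
    exact ⟨k, hτ, hyk, s, ⟨hs.1, hle⟩, r, hr, he⟩
  · have hτ' := not_le.1 hτ
    refine key (τ k) hτ'.le hk le_rfl ?_
    rw [h.begin_at_start k (h0.trans_lt hτ') (hk.trans h1)]
    exact hs.1

/-- Sweeping in a coordinated way from a clear region expands it. -/
theorem IsSweeping.isClear_union [Finite ι] (hE : IsSimplePolygon E) (hP : IsPTSSPartition E P)
    (hp : IsPTSSTree E P root p) (hS : IsSweepPlan P root p S) {t₀ t₁ : ℝ}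
    {θ : ι → ℝ → Real.Angle} {τ : ι → ℝ} {a : ι → ℝ → ℝ} {D : Set Plane} (ht₀ : 0 ≤ t₀)
    (hθ : ∀ k, ContinuousOn (θ k) (Icc 0 t₁)) (h : IsSweeping P root p S t₀ t₁ θ τ a)
    (hclear : IsClear E p θ t₀ D)
    (hsub : sweptRegion P p S (fun k => τ k ≤ t₀) (fun k => a k t₀) ⊆ D)
    (hbd : relBoundary E D ⊆ sweptRegion P p S (fun k => τ k ≤ t₀) (fun k => a k t₀) ∪
      {x | ∀ t ∈ Icc t₀ t₁, Illuminated E p θ t x}) {t : ℝ} (ht : t ∈ Icc t₀ t₁) :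
    IsClear E p θ t (D ∪ sweptRegion P p S (fun k => τ k ≤ t) (fun k => a k t)) := by
  have hθ' : ∀ k, ContinuousOn (θ k) (Icc t₀ t₁) :=
    fun k => (hθ k).mono (Icc_subset_Icc_left ht₀)
  have hstart : ∀ x ∈ D ∪ sweptRegion P p S (fun k => τ k ≤ t₀) (fun k => a k t₀),
      ¬ Contaminated E p θ t₀ x := by
    rintro x (hx | hx)
    exacts [hclear x hx, hclear x (hsub hx)]
  have hWmono : sweptRegion P p S (fun k => τ k ≤ t₀) (fun k => a k t₀) ⊆
      sweptRegion P p S (fun k => τ k ≤ t) (fun k => a k t) := by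
    rintro x ⟨k, hk, hx⟩
    exact ⟨k, hk.trans ht.1, (S k).swept_mono _ _
      (h.mono k t₀ ⟨le_rfl, ht.1.trans ht.2⟩ t ht hk ht.1) hx⟩
  intro x hx hcon
  induction hcon with
  | initial x hxE hdark =>
    have h0 : t₀ = 0 := le_antisymm ht.1 ht₀
    subst h0
    exact hstart x hx (.initial x hxE hdark)
  | spread t t' x y hxE h0 htt hy hdark hsep ih =>
    rcases ht.1.eq_or_lt with rfl | hlt
    · exact hstart x hx (.spread t₀ t' x y hxE h0 htt hy hdark hsep)
    -- a time after `t₀` from which `y` is dark and not in the clear region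
    obtain ⟨u, hu0, hut, hdu, hyu⟩ : ∃ u, t₀ ≤ u ∧ u ≤ t ∧
        (∀ s ∈ Icc u t, ¬ Illuminated E p θ s y) ∧
        y ∉ D ∪ sweptRegion P p S (fun k => τ k ≤ u) (fun k => a k u) := by
      by_cases hc : t₀ ≤ t'
      -- The induction hypothesis asks for the growth of the swept region up to `t'` instead of `t`.
      · refine ⟨t', hc, htt.le, hdark, fun hyR => ih ⟨hc, htt.le.trans ht.2⟩ ?_ hyR⟩
        rintro z ⟨k, hk, hz⟩
        exact ⟨k, hk.trans hc, (S k).swept_mono _ _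
          (h.mono k t₀ ⟨le_rfl, ht.1.trans ht.2⟩ t' ⟨hc, htt.le.trans ht.2⟩ hk hc) hz⟩
      · have hc' := not_le.1 hc
        refine ⟨t₀, le_rfl, hlt.le, fun s hs => hdark s ⟨hc'.le.trans hs.1, hs.2⟩,
          fun hyR => hstart y hyR ?_⟩
        -- A source older than `t₀` is still contaminated at `t₀`: it has stayed dark, and the
        -- constant curve shows it is not separable from itself.
        refine .spread t₀ t' y y hy.mem h0 hc' hy
          (fun s hs => hdark s ⟨hs.1, hs.2.trans hlt.le⟩) fun hs => ?_
        obtain ⟨s, hs⟩ := hs (Path.refl y) (fun s => by simp)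
        exact hdark t₀ ⟨hc'.le, hlt.le⟩ (by simpa using hs)
    have hyt : y ∉ D ∪ sweptRegion P p S (fun k => τ k ≤ t) (fun k => a k t) := by
      rintro (hyD | hyW)
      · exact hyu (Or.inl hyD)
      · obtain ⟨v, hv, hvl⟩ := h.exists_illuminated hP hp hS hθ' hu0 hut ht.2 hyW
          (fun hw => hyu (Or.inr hw))
        exact hdu v hv hvl
    refine hsep fun γ hγ => ?_
    obtain ⟨s, hs⟩ := Path.exists_mem_relBoundary (E := E) γ (fun s => by
      rcases hγ s with h | h | h
      · exact interior_subset h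
      · rw [h]; exact hxE
      · rw [show γ s = y from h]; exact hy.mem) hx hyt
    refine ⟨s, relBoundary_union_sweptRegion_subset hE hP hp hS (h.coordinated t ht)
      (fun k hk => h.aim k t ht hk) ?_ hs⟩
    exact hbd.trans (union_subset_union hWmono fun z hz => hz t ht)

end Expansion

/-! ### Existence of sweep plans -/

namespace IsLocalSector

variable {Q : Set Plane} {c : Plane} {δ α β : ℝ}

/-- Moving a point of `Q` towards the kernel point `c` keeps it in `Q` and its direction fixed, so
the local sector bounds all directions. -/
lemma exists_angle (h : IsLocalSector Q c δ α β) (hc : c ∈ starKernel Q) {x : Plane}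
    (hx : x ∈ Q) (hxc : x ≠ c) :
    ∃ r : ℝ, 0 < r ∧ ∃ φ ∈ Icc α β, x = c + r • dir (φ : ℝ) := by
  obtain ⟨r, hr, φ, hφ, rfl⟩ := exists_polar hxc α
  refine ⟨r, hr, φ, ⟨hφ.1, ?_⟩, rfl⟩
  by_contra hlt
  have hm : 0 < min r δ := lt_min hr h.pos
  refine h.outer (min r δ / 2) ⟨by positivity, ?_⟩ φ ⟨not_le.1 hlt, hφ.2⟩ ?_
  · linarith [min_le_right r δ]
  · exact hc.2 _ hx ((mem_segment_add_smul_dir hr).2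
      ⟨_, ⟨by positivity, by linarith [min_le_left r δ]⟩, rfl⟩)

lemma exists_mem (h : IsLocalSector Q c δ α β) (hQ : IsClosed Q) {φ : ℝ} (hφ : φ ∈ Icc α β) :
    ∃ r : ℝ, 0 < r ∧ c + r • dir (φ : ℝ) ∈ Q := by
  have hδ : δ / 2 ∈ Ioo 0 δ := ⟨half_pos h.pos, half_lt_self h.pos⟩
  refine ⟨δ / 2, hδ.1, ?_⟩
  rcases hφ.1.eq_or_lt with rfl | h1
  · exact hQ.frontier_subset (h.left _ hδ)
  rcases hφ.2.eq_or_lt with rfl | h2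
  · exact hQ.frontier_subset (h.right _ hδ)
  · exact interior_subset (h.inner _ hδ φ ⟨h1, h2⟩)

/-- The sweep may start at either edge of the sector; the gap to the parent decides which of this
and `covers_right` is needed. -/
lemma covers_left (h : IsLocalSector Q c δ α β) (hc : c ∈ starKernel Q) (hQ : IsClosed Q) :
    (Sweep.mk α 1 (β - α)).Covers c Q := by
  refine ⟨Or.inl rfl, sub_pos.2 h.lt, by simpa [sub_lt_iff_lt_add'] using h.lt_add, ?_, ?_⟩
  · intro x hx hxc
    obtain ⟨r, hr, φ, hφ, rfl⟩ := h.exists_angle hc hx hxc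
    exact ⟨φ - α, ⟨by linarith [hφ.1], by linarith [hφ.2]⟩, r, hr, by simp [Sweep.angle]⟩
  · intro s hs
    simp only [Sweep.angle, one_mul]
    exact h.exists_mem hQ ⟨by linarith [hs.1], by linarith [hs.2]⟩

lemma covers_right (h : IsLocalSector Q c δ α β) (hc : c ∈ starKernel Q) (hQ : IsClosed Q) :
    (Sweep.mk β (-1) (β - α)).Covers c Q := by
  refine ⟨Or.inr rfl, sub_pos.2 h.lt, by simpa [sub_lt_iff_lt_add'] using h.lt_add, ?_, ?_⟩
  · intro x hx hxc
    obtain ⟨r, hr, φ, hφ, rfl⟩ := h.exists_angle hc hx hxc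
    refine ⟨β - φ, ⟨by linarith [hφ.2], by linarith [hφ.1]⟩, r, hr, ?_⟩
    rw [Sweep.angle, show β + -1 * (β - φ) = φ by ring]
  · intro s hs
    simp only [Sweep.angle]
    exact h.exists_mem hQ ⟨by linarith [hs.2], by linarith [hs.1]⟩

end IsLocalSector

section Plan

variable {ι : Type*} {E : Set Plane} {P : ι → Set Plane} {root : ι} {p : ι → Plane}

/-- The gap between a cell and its parent starts at the position of the agent. -/
lemma IsPTSSTree.exists_gap_eq (hP : IsPTSSPartition E P) (hp : IsPTSSTree E P root p) {j k : ι}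
    (hjk : IsParent P root j k) : ∃ q, q ≠ p k ∧ P j ∩ P k = segment ℝ (p k) q ∧
      openSegment ℝ (p k) q ⊆ interior E := by
  obtain ⟨v, v', hgap, heq⟩ := hP.gaps.gap j k hjk.1
  obtain ⟨⟨hmem, -⟩, hfr⟩ := hp.child_pos j k hjk
  obtain ⟨q, hq, hqo⟩ : ∃ q, P j ∩ P k = segment ℝ (p k) q ∧
      openSegment ℝ (p k) q ⊆ interior E := by
    rw [heq, ← insert_endpoints_openSegment] at hmem
    rcases hmem with h | h | h
    · exact ⟨v', by rw [h, heq], by rw [h]; exact hgap.2.2⟩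
    · exact ⟨v, by rw [h, heq, segment_symm], by
        rw [h, openSegment_symm]; exact hgap.2.2⟩
    · exact absurd (hgap.2.2 h) hfr.2
  refine ⟨q, ?_, hq, hqo⟩
  rintro rfl
  rw [openSegment_same] at hqo
  exact hfr.2 (hqo rfl)

lemma IsPTSSTree.exists_sweep (hP : IsPTSSPartition E P) (hp : IsPTSSTree E P root p) (k : ι) :
    ∃ S : Sweep, S.Covers (p k) (P k) ∧ ∀ j, IsParent P root j k → ∀ x ∈ P j ∩ P k,
      ∃ r : ℝ, 0 ≤ r ∧ x = p k + r • dir (S.angle 0) := by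
  obtain ⟨hker, hfrE⟩ := hp.pos_mem hP k
  have hcl := (hP.isSimplePolygon_cell k).isClosed
  have hfr : p k ∈ frontier (P k) :=
    ⟨subset_closure hker.1, fun h => hfrE.2 (interior_mono (hP.cell_subset k) h)⟩
  obtain ⟨δ, α, β, h⟩ := (hP.isSimplePolygon_cell k).exists_isLocalSector hfr
  by_cases hpar : ∃ j, IsParent P root j k
  swap
  · exact ⟨_, h.covers_left hker hcl, fun j hj => absurd ⟨j, hj⟩ hpar⟩
  obtain ⟨j, hj⟩ := hpar
  obtain ⟨q, hq, hseg, hopen⟩ := hp.exists_gap_eq hP hj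
  have hqk : q ∈ P j ∩ P k := hseg ▸ right_mem_segment _ _ _
  obtain ⟨r, hr, φ, hφ, rfl⟩ := h.exists_angle hker hqk.2 hq
  have hray : ∀ j', IsParent P root j' k → ∀ x ∈ P j' ∩ P k,
      ∃ r : ℝ, 0 ≤ r ∧ x = p k + r • dir (φ : ℝ) := by
    intro j' hj' x hx
    rw [hj'.unique hP.tree hj, hseg, mem_segment_add_smul_dir hr] at hx
    obtain ⟨s, hs, he⟩ := hx
    exact ⟨s, hs.1, he⟩
  -- A gap running strictly between the edges would contain interior points of `P k`, but points
  -- shared by two cells are on the frontier.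
  have hends : φ = α ∨ φ = β := by
    by_contra hne
    push Not at hne
    have hm : 0 < min r δ := lt_min hr h.pos
    have hin := h.inner (min r δ / 2) ⟨by positivity, by linarith [min_le_right r δ]⟩ φ
      ⟨hφ.1.lt_of_ne hne.1.symm, hφ.2.lt_of_ne hne.2⟩
    have hmem : p k + (min r δ / 2) • dir (φ : ℝ) ∈ P j ∩ P k := by
      rw [hseg, mem_segment_add_smul_dir hr]
      exact ⟨_, ⟨by positivity, by linarith [min_le_left r δ]⟩, rfl⟩
    exact (hP.mem_frontier_of_mem hj.ne.symm hmem.2 hmem.1).2 hin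
  rcases hends with rfl | rfl
  · exact ⟨_, h.covers_left hker hcl, by simpa [Sweep.angle] using hray⟩
  · exact ⟨_, h.covers_right hker hcl, by simpa [Sweep.angle] using hray⟩

theorem IsPTSSTree.exists_isSweepPlan (hP : IsPTSSPartition E P) (hp : IsPTSSTree E P root p) :
    ∃ S : ι → Sweep, IsSweepPlan P root p S := by
  choose S hS hS' using hp.exists_sweep hP
  exact ⟨S, hS, fun j k h => hS' k j h⟩

end Plan

/-! ### Continuing a schedule across a gap -/

section Contamination

variable {ι : Type*} {E : Set Plane} {p : ι → Plane}

/-- Contamination depends only on the past. -/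
lemma Contaminated.congr {θ θ' : ι → ℝ → Real.Angle} {t₀ : ℝ}
    (h : ∀ k, ∀ t ∈ Icc 0 t₀, θ' k t = θ k t) {t : ℝ} {x : Plane}
    (hx : Contaminated E p θ' t x) (ht : t ≤ t₀) : Contaminated E p θ t x := by
  have hill : ∀ s ∈ Icc 0 t₀, ∀ y, Illuminated E p θ' s y ↔ Illuminated E p θ s y :=
    fun s hs y => exists_congr fun k => by rw [h k s hs]
  induction hx with
  | initial x hx hdark => exact .initial x hx (by rwa [← hill 0 ⟨le_rfl, ht⟩])
  | spread t t' x y hx h0 htt hy hdark hsep ih =>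
    refine .spread t t' x y hx h0 htt (ih (htt.le.trans ht)) (fun s hs => ?_) fun hs => hsep ?_
    · rw [← hill s ⟨h0.trans hs.1, hs.2.trans ht⟩]
      exact hdark s hs
    · intro γ hγ
      obtain ⟨s, hl⟩ := hs γ hγ
      exact ⟨s, (hill t ⟨h0.trans htt.le, ht⟩ _).2 hl⟩

end Contamination

/-- The function growing linearly from `0` to `1` on the unit interval, and constant elsewhere. -/
def ramp (x : ℝ) : ℝ := max 0 (min 1 x)

lemma continuous_ramp : Continuous ramp := by unfold ramp; fun_prop

lemma ramp_mono : Monotone ramp := fun _ _ h => max_le_max le_rfl (min_le_min le_rfl h)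

lemma ramp_nonneg (x : ℝ) : 0 ≤ ramp x := le_max_left _ _

lemma ramp_le_one (x : ℝ) : ramp x ≤ 1 := max_le zero_le_one (min_le_left _ _)

lemma ramp_of_nonpos {x : ℝ} (h : x ≤ 0) : ramp x = 0 :=
  max_eq_left ((min_le_right _ _).trans h)

lemma ramp_of_one_le {x : ℝ} (h : 1 ≤ x) : ramp x = 1 := by
  rw [ramp, min_eq_left h, max_eq_right zero_le_one]

lemma ramp_of_mem {x : ℝ} (h : x ∈ Icc (0 : ℝ) 1) : ramp x = x := by
  rw [ramp, min_eq_right h.2, max_eq_right h.1]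

lemma ramp_strictMonoOn (c : ℝ) : StrictMonoOn (fun t => ramp (t - c)) (Icc c (c + 1)) := by
  intro s hs t ht hst
  simp only
  rw [ramp_of_mem ⟨by linarith [hs.1], by linarith [hs.2]⟩,
    ramp_of_mem ⟨by linarith [ht.1], by linarith [ht.2]⟩]
  linarith

section Continuation

variable {ι : Type*} {E : Set Plane} {P : ι → Set Plane} {root : ι} {p : ι → Plane}
  {S : ι → Sweep}

/-- An agent can sweep exactly over a subset of its cell. -/
lemma Sweep.Covers.exists_subset_swept {S : Sweep} {c : Plane} {Q G : Set Plane}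
    (h : S.Covers c Q) (hG : G ⊆ Q) {a : ℝ} (ha : a ∈ Icc 0 S.width) :
    ∃ b ∈ Icc a S.width, G ⊆ S.swept c Q b := by
  -- Including `a` makes the set nonempty and its supremum at least `a`.
  set T : Set ℝ := insert a {s | s ∈ Icc 0 S.width ∧ ∃ r : ℝ, 0 < r ∧ c + r • dir (S.angle s) ∈ G}
  have hT : ∀ s ∈ T, s ≤ S.width := by
    rintro s (rfl | hs)
    exacts [ha.2, hs.1.2]
  have hbdd : BddAbove T := ⟨S.width, hT⟩
  have hab : a ≤ sSup T := le_csSup hbdd (mem_insert _ _)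
  refine ⟨sSup T, ⟨hab, csSup_le ⟨a, mem_insert _ _⟩ hT⟩, fun x hx => ⟨hG hx, ?_⟩⟩
  by_cases hxc : x = c
  · exact ⟨0, ⟨le_rfl, ha.1.trans hab⟩, 0, le_rfl, by simp [hxc]⟩
  · obtain ⟨s, hs, r, hr, he⟩ := h.2.2.2.1 x (hG hx) hxc
    exact ⟨s, ⟨hs.1, le_csSup hbdd (mem_insert_of_mem _ ⟨hs, r, hr, he ▸ hx⟩)⟩, r, hr.le, he⟩

/-- The angles turned through when the clear region is expanded from the cell of `i` to that of
`j` from the time `t` on: `i` turns to `b` between `t + 1` and `t + 2`, and then both agents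
complete their sweeps until `t + 3`. -/
def expansionAngle [DecidableEq ι] (S : ι → Sweep) (i j : ι) (a₀ : ι → ℝ) (b t₀ : ℝ) (k : ι)
    (t : ℝ) : ℝ :=
  if k = i then a₀ i + (b - a₀ i) * ramp (t - (t₀ + 1)) + ((S i).width - b) * ramp (t - (t₀ + 2))
  else if k = j then (S j).width * ramp (t - (t₀ + 2))
  else a₀ k

section

variable [DecidableEq ι] {i j : ι} {a₀ : ι → ℝ} {b t₀ : ℝ}

lemma continuous_expansionAngle (k : ι) : Continuous (expansionAngle S i j a₀ b t₀ k) := by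
  have h : ∀ c : ℝ, Continuous fun t => ramp (t - c) :=
    fun c => continuous_ramp.comp (continuous_id.sub continuous_const)
  have h1 := h (t₀ + 1)
  have h2 := h (t₀ + 2)
  unfold expansionAngle
  split_ifs <;> fun_prop

lemma monotone_expansionAngle (hb : b ∈ Icc (a₀ i) (S i).width) (hj : 0 < (S j).width) (k : ι) :
    Monotone (expansionAngle S i j a₀ b t₀ k) := by
  intro s t hst
  have h1 := ramp_mono (show s - (t₀ + 1) ≤ t - (t₀ + 1) by linarith)
  have h2 := ramp_mono (show s - (t₀ + 2) ≤ t - (t₀ + 2) by linarith)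
  have hb1 := sub_nonneg.2 hb.1
  have hb2 := sub_nonneg.2 hb.2
  unfold expansionAngle
  split_ifs
  · gcongr
  · gcongr
  · exact le_rfl

lemma expansionAngle_of_le (haj : a₀ j = 0) {t : ℝ} (ht : t ≤ t₀ + 1) (k : ι) :
    expansionAngle S i j a₀ b t₀ k t = a₀ k := by
  unfold expansionAngle
  rw [ramp_of_nonpos (by linarith), ramp_of_nonpos (by linarith)]
  split_ifs with h1 h2
  · subst h1; ring
  · rw [h2, haj, mul_zero]
  · rfl

lemma expansionAngle_other {k : ι} (hi : k ≠ i) (hj : k ≠ j) (t : ℝ) :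
    expansionAngle S i j a₀ b t₀ k t = a₀ k := by
  rw [expansionAngle, if_neg hi, if_neg hj]

lemma expansionAngle_right (hij : i ≠ j) (t : ℝ) :
    expansionAngle S i j a₀ b t₀ j t = (S j).width * ramp (t - (t₀ + 2)) := by
  rw [expansionAngle, if_neg hij.symm, if_pos rfl]

lemma expansionAngle_left {t : ℝ} (ht : t₀ + 2 ≤ t) :
    expansionAngle S i j a₀ b t₀ i t = b + ((S i).width - b) * ramp (t - (t₀ + 2)) := by
  rw [expansionAngle, if_pos rfl, ramp_of_one_le (show 1 ≤ t - (t₀ + 1) by linarith)]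
  ring

lemma expansionAngle_mem (hb : b ∈ Icc (a₀ i) (S i).width) (hj : 0 < (S j).width) (haj : a₀ j = 0)
    {k : ι} (hk : a₀ k ∈ Icc 0 (S k).width) {t : ℝ} (ht : t₀ ≤ t) :
    expansionAngle S i j a₀ b t₀ k t ∈ Icc 0 (S k).width := by
  constructor
  · rw [← expansionAngle_of_le (S := S) (i := i) (b := b) (t₀ := t₀) haj
      (show t₀ ≤ t₀ + 1 by linarith) k] at hk
    exact hk.1.trans (monotone_expansionAngle hb hj k ht)
  · by_cases hki : k = i
    · subst hki
      -- By monotonicity it suffices to bound a time after `t₀ + 3`, where the angle is exactly the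
      -- full width.
      have h := monotone_expansionAngle (t₀ := t₀) hb hj k (le_max_left t (t₀ + 3))
      rw [expansionAngle_left (show t₀ + 2 ≤ max t (t₀ + 3) from
          le_trans (by linarith) (le_max_right _ _)),
        ramp_of_one_le (by linarith [le_max_right t (t₀ + 3)])] at h
      linarith
    · by_cases hkj : k = j
      · subst hkj
        rw [expansionAngle_right (Ne.symm hki)]
        exact mul_le_of_le_one_right hj.le (ramp_le_one _)
      · rw [expansionAngle_other hki hkj]
        exact hk.2

end

open Classical in
/-- The times of engagement when the children of `i` and `j` become engaged at time `t₁`. -/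
def expansionStart (P : ι → Set Plane) (root i j : ι) (on : ι → Prop) (t₀ : ℝ) (k : ι) : ℝ :=
  if on k then t₀
  else if IsParent P root i k ∨ IsParent P root j k then t₀ + 1 else t₀ + 4

lemma expansionStart_of_on {i j : ι} {on : ι → Prop} {t₀ : ℝ} {k : ι} (hk : on k) :
    expansionStart P root i j on t₀ k = t₀ := if_pos hk

lemma expansionStart_of_child {i j : ι} {on : ι → Prop} {t₀ : ℝ} {k : ι}
    (hk : IsParent P root i k ∨ IsParent P root j k) :
    expansionStart P root i j on t₀ k ≤ t₀ + 1 := by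
  unfold expansionStart
  split_ifs <;> linarith

lemma expansionStart_cases {i j : ι} {on : ι → Prop} {t₀ : ℝ} (k : ι) :
    on k ∧ expansionStart P root i j on t₀ k = t₀ ∨
    (¬ on k ∧ (IsParent P root i k ∨ IsParent P root j k) ∧
      expansionStart P root i j on t₀ k = t₀ + 1) ∨
    (¬ on k ∧ ¬ (IsParent P root i k ∨ IsParent P root j k) ∧
      expansionStart P root i j on t₀ k = t₀ + 4) := by
  unfold expansionStart
  split_ifs with h1 h2
  · exact Or.inl ⟨h1, rfl⟩
  · exact Or.inr (Or.inl ⟨h1, h2, rfl⟩)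
  · exact Or.inr (Or.inr ⟨h1, h2, rfl⟩)

lemma expansionStart_le_iff {i j : ι} {on : ι → Prop} {t₀ : ℝ} (k : ι) :
    expansionStart P root i j on t₀ k ≤ t₀ ↔ on k := by
  rcases expansionStart_cases (P := P) (root := root) (i := i) (j := j) (on := on) (t₀ := t₀) k
    with ⟨h, he⟩ | ⟨h, -, he⟩ | ⟨h, -, he⟩
  · simp [h, he]
  · simp [h, he]
  · simp [h, he]

/-- The states passed when the clear region is expanded from `i` to `j` are coordinated. -/
lemma coordinated_expansion [DecidableEq ι] (hT : (dualGraph P).IsTree)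
    (hS : IsSweepPlan P root p S) {i j : ι} (hij : IsParent P root i j) {on : ι → Prop}
    {a₀ : ι → ℝ} {b t₀ : ℝ} (ha₀ : ∀ k, ¬ on k → a₀ k = 0)
    (hco : Coordinated P root p S on a₀) (hi : on i) (hrel : Released P root p S on a₀ i)
    (hj : ¬ on j) (hb : b ∈ Icc (a₀ i) (S i).width)
    (hgap : P i ∩ P j ⊆ (S i).swept (p i) (P i) b) {t : ℝ} (ht : t₀ ≤ t) :
    Coordinated P root p S (fun k => expansionStart P root i j on t₀ k ≤ t)
      (fun k => expansionAngle S i j a₀ b t₀ k t) := by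
  have hwj : 0 < (S j).width := (hS.1 j).2.1
  have haj : a₀ j = 0 := ha₀ j hj
  have hmono := monotone_expansionAngle (t₀ := t₀) hb hwj
  have hle : ∀ k, a₀ k ≤ expansionAngle S i j a₀ b t₀ k t := fun k => by
    rw [← expansionAngle_of_le (S := S) (i := i) (b := b) (t₀ := t₀) haj
      (show t₀ ≤ t₀ + 1 by linarith) k]
    exact hmono k ht
  have hrel' : ∀ k, Released P root p S on a₀ k → Released P root p S
      (fun k => expansionStart P root i j on t₀ k ≤ t)
      (fun k => expansionAngle S i j a₀ b t₀ k t) k := by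
    intro k hk h hh
    obtain ⟨hon, hsub⟩ := hk h hh
    exact ⟨(expansionStart_of_on hon).trans_le ht,
      hsub.trans ((S h).swept_mono _ _ (hle h))⟩
  refine ⟨fun k _ => ?_, fun h k hk hon hbeg => ?_, fun k hon hpos => ?_⟩
  · refine expansionAngle_mem hb hwj haj ?_ ht
    by_cases hon : on k
    · exact hco.range k hon
    · rw [ha₀ k hon]
      exact ⟨le_rfl, (hS.1 k).2.1.le⟩
  · have hinit : on h → (S h).Begun (p h) (P h ∩ P k) (a₀ h) →
        expansionStart P root i j on t₀ k ≤ t := fun h1 h2 =>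
      (expansionStart_of_on (hco.child_aimed h k hk h1 h2)).trans_le ht
    have hzero : ¬ on h → ¬ (S h).Begun (p h) (P h ∩ P k) (a₀ h) := by
      rintro h1 ⟨s, hs0, hs1, -⟩
      rw [ha₀ h h1] at hs1
      linarith
    -- Until `t₀ + 1` no engaged agent turns and the initial coordination applies; afterwards all
    -- children of `i` and `j` are engaged.
    by_cases hearly : t ≤ t₀ + 1
    · simp only [expansionAngle_of_le haj hearly] at hbeg
      by_cases hh : on h
      · exact hinit hh hbeg
      · exact absurd hbeg (hzero hh)
    · by_cases hhi : h = i
      · exact (expansionStart_of_child (Or.inl (hhi ▸ hk))).trans (not_le.1 hearly).le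
      by_cases hhj : h = j
      · exact (expansionStart_of_child (Or.inr (hhj ▸ hk))).trans (not_le.1 hearly).le
      simp only [expansionAngle_other hhi hhj] at hbeg
      by_cases hh : on h
      · exact hinit hh hbeg
      · exact absurd hbeg (hzero hh)
  · by_cases hki : k = i
    · exact hrel' k (hki ▸ hrel)
    by_cases hkj : k = j
    · subst hkj
      -- Agent `j` turns only after `t₀ + 2`, when `i` has reached `b` and thus slewed over the gap.
      have hlate : t₀ + 2 ≤ t := by
        by_contra hlt
        simp only [expansionAngle_right hij.ne] at hpos
        rw [ramp_of_nonpos (by linarith), mul_zero] at hpos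
        exact hpos.false
      intro h hh
      obtain rfl := hh.unique hT hij
      refine ⟨(expansionStart_of_on hi).trans_le ht,
        hgap.trans ((S h).swept_mono _ _ ?_)⟩
      simp only [expansionAngle_left hlate]
      nlinarith [ramp_nonneg (t - (t₀ + 2)), hb.2]
    · simp only [expansionAngle_other hki hkj] at hpos
      have hon' : on k := by
        by_contra hn
        rw [ha₀ k hn] at hpos
        exact hpos.false
      exact hrel' k (hco.child_waits k hon' hpos)

/-- A schedule can be continued so that given agents follow their sweeps: the agents with `on k`
at once, those with `next k` from the time `t₀ + 1` on, when they have turned to their start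
directions, while the others stay aimed as they are. -/
lemma exists_continuation (S : ι → Sweep) {θ : ι → ℝ → Real.Angle} {t₀ : ℝ}
    (hθ : ∀ k, ContinuousOn (θ k) (Icc 0 t₀)) (on next : ι → Prop) {a : ι → ℝ → ℝ}
    (ha : ∀ k, Continuous (a k)) (hconst : ∀ k, ∀ t ≤ t₀, a k t = a k t₀)
    (hzero : ∀ k, ¬ on k → a k t₀ = 0) (ht₀ : 0 ≤ t₀)
    (haim : ∀ k, on k → θ k t₀ = (S k).angle (a k t₀)) :
    ∃ θ' : ι → ℝ → Real.Angle, (∀ k t, ContinuousOn (θ' k) (Icc 0 t)) ∧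
      (∀ k, ∀ t ≤ t₀, θ' k t = θ k t) ∧
      (∀ k, on k → ∀ t, t₀ ≤ t → θ' k t = (S k).angle (a k t)) ∧
      (∀ k, ¬ on k → next k → ∀ t, t₀ + 1 ≤ t → θ' k t = (S k).angle (a k t)) ∧
      (∀ k, ¬ on k → ¬ next k → ∀ t, t₀ ≤ t → θ' k t = θ k t₀) := by
  classical
  have hc : ∀ k, ∃ c : ℝ, (c : Real.Angle) = θ k t₀ := fun k => by
    induction θ k t₀ using Real.Angle.induction_on with
    | h x => exact ⟨x, rfl⟩
  choose c hc using hc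
  -- A real displacement is added to the direction frozen at `t₀`. Agents in `next` use the first
  -- unit of time to turn from `c k` to their start angle.
  let δ : ι → ℝ → ℝ := fun k t =>
    if on k then (S k).orient * (a k t - a k t₀)
    else if next k then ((S k).start - c k) * ramp (t - t₀) + (S k).orient * a k t
    else 0
  have hδ : ∀ k, Continuous (δ k) := by
    intro k
    have h1 := ha k
    have h2 : Continuous fun t => ramp (t - t₀) :=
      continuous_ramp.comp (continuous_id.sub continuous_const)
    simp only [δ]
    split_ifs <;> fun_prop
  have hδ0 : ∀ k, ∀ t ≤ t₀, δ k t = 0 := by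
    intro k t ht
    simp only [δ]
    split_ifs with h1 h2
    · rw [hconst k t ht]; ring
    · rw [hconst k t ht, hzero k h1, ramp_of_nonpos (by linarith)]; ring
    · rfl
  refine ⟨fun k t => θ k (min t t₀) + (δ k t : ℝ), fun k t => ?_, fun k t ht => ?_,
    fun k hk t ht => ?_, fun k hk hn t ht => ?_, fun k hk hn t ht => ?_⟩
  · refine ContinuousOn.add ((hθ k).comp (by fun_prop) fun s hs => ?_)
      (Real.Angle.continuous_coe.comp (hδ k)).continuousOn
    exact ⟨le_min hs.1 ht₀, min_le_right _ _⟩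
  · simp only [hδ0 k t ht, min_eq_left ht, Real.Angle.coe_zero, add_zero]
  · simp only [min_eq_right ht, haim k hk, δ, if_pos hk, Sweep.angle, ← Real.Angle.coe_add]
    congr 1
    ring
  · simp only [min_eq_right (show t₀ ≤ t by linarith), ← hc k, δ, if_neg hk, if_pos hn,
      Sweep.angle, ← Real.Angle.coe_add]
    rw [ramp_of_one_le (by linarith)]
    congr 1
    ring
  · simp only [min_eq_right ht, δ, if_neg hk, if_neg hn, Real.Angle.coe_zero, add_zero]

end Continuation

/-! ### Angles of agents that are not engaged are irrelevant -/

section Congr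

variable {ι : Type*} {P : ι → Set Plane} {root : ι} {p : ι → Plane} {S : ι → Sweep}
  {on : ι → Prop} {a a' : ι → ℝ}

lemma Released.congr (h : ∀ k, on k → a k = a' k) {k : ι} (hk : Released P root p S on a k) :
    Released P root p S on a' k := fun j hj => by
  rw [← h j (hk j hj).1]
  exact hk j hj

lemma Coordinated.congr (h : ∀ k, on k → a k = a' k) (hco : Coordinated P root p S on a) :
    Coordinated P root p S on a' := by
  refine ⟨fun k hk => ?_, fun j k hjk hj hb => ?_, fun k hk hpos => ?_⟩
  · rw [← h k hk]; exact hco.range k hk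
  · rw [← h j hj] at hb; exact hco.child_aimed j k hjk hj hb
  · rw [← h k hk] at hpos; exact (hco.child_waits k hk hpos).congr h

lemma sweptRegion_congr {on' : ι → Prop} (hon : ∀ k, on k ↔ on' k) (h : ∀ k, on k → a k = a' k) :
    sweptRegion P p S on a = sweptRegion P p S on' a' := by
  ext x
  refine exists_congr fun k => ⟨fun hx => ?_, fun hx => ?_⟩
  · rw [← h k hx.1]; exact ⟨(hon k).1 hx.1, hx.2⟩
  · rw [h k ((hon k).2 hx.1)]; exact ⟨(hon k).2 hx.1, hx.2⟩

end Congr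

end

/-! ### The expansion lemma -/

theorem mainTheorem5 {ι : Type*} [Fintype ι] (E : Set Plane) (hE : IsSimplePolygon E)
    (P : ι → Set Plane) (hP : IsPTSSPartition E P)
    (root : ι) (p : ι → Plane) (hp : IsPTSSTree E P root p)
    (i j : ι) (hij : IsParent P root i j) :
    (∃ S : ι → Sweep, IsSweepPlan P root p S) ∧
    ∀ S : ι → Sweep, IsSweepPlan P root p S →
      -- every coordinated sweep expands a clear region
      (∀ (t₀ t₁ : ℝ) (θ : ι → ℝ → Real.Angle) (τ : ι → ℝ) (a : ι → ℝ → ℝ) (D : Set Plane),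
        0 ≤ t₀ → t₀ ≤ t₁ → (∀ k, ContinuousOn (θ k) (Icc 0 t₁)) →
        IsSweeping P root p S t₀ t₁ θ τ a →
        D ⊆ E → IsClear E p θ t₀ D →
        sweptRegion P p S (fun k => τ k ≤ t₀) (fun k => a k t₀) ⊆ D →
        relBoundary E D ⊆ sweptRegion P p S (fun k => τ k ≤ t₀) (fun k => a k t₀) ∪
          {x | ∀ t ∈ Icc t₀ t₁, Illuminated E p θ t x} →
        ∀ t ∈ Icc t₀ t₁,
          IsClear E p θ t (D ∪ sweptRegion P p S (fun k => τ k ≤ t) (fun k => a k t))) ∧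
      -- the clear region can always be expanded from `P i` to `P j`
      (∀ (t₀ : ℝ) (θ : ι → ℝ → Real.Angle) (on : ι → Prop) (a₀ : ι → ℝ) (D : Set Plane),
        0 ≤ t₀ → (∀ k, ContinuousOn (θ k) (Icc 0 t₀)) →
        (∀ k, on k → θ k t₀ = (S k).angle (a₀ k)) →
        Coordinated P root p S on a₀ →
        on i → Released P root p S on a₀ i → ¬ on j →
        D ⊆ E → IsClear E p θ t₀ D →
        sweptRegion P p S on a₀ ⊆ D →
        relBoundary E D ⊆ sweptRegion P p S on a₀ ∪
          {x | ∃ k, k ≠ i ∧ k ≠ j ∧ ¬ IsParent P root i k ∧ ¬ IsParent P root j k ∧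
            x ∈ lightRay E (p k) (θ k t₀)} →
        ∃ (t₁ t₂ t₃ : ℝ) (θ' : ι → ℝ → Real.Angle) (τ : ι → ℝ) (a : ι → ℝ → ℝ),
          t₀ < t₁ ∧ t₁ < t₂ ∧ t₂ < t₃ ∧
          -- the schedule is continued in a coordinated way
          (∀ k, ContinuousOn (θ' k) (Icc 0 t₃)) ∧
          (∀ k, ∀ t ∈ Icc 0 t₀, θ' k t = θ k t) ∧
          (∀ k, τ k ≤ t₀ ↔ on k) ∧ (∀ k, on k → a k t₀ = a₀ k) ∧
          IsSweeping P root p S t₀ t₃ θ' τ a ∧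
          -- of the engaged agents only `i` and `j` slew; agents other than `i`, `j` and their
          -- children do not move at all
          (∀ k, k ≠ i → k ≠ j → ∀ t ∈ Icc t₀ t₃, τ k ≤ t → a k t = a k (max t₀ (τ k))) ∧
          (∀ k, k ≠ i → k ≠ j → ¬ IsParent P root i k → ¬ IsParent P root j k →
            ∀ t ∈ Icc t₀ t₃, θ' k t = θ k t₀) ∧
          -- `j` aims across the gap, while `i` has not begun to slew over it
          (∀ t ∈ Icc t₀ t₁, a i t = a₀ i) ∧ ¬ (S i).Begun (p i) (P i ∩ P j) (a i t₁) ∧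
          τ j ≤ t₁ ∧
          -- `j` keeps aiming across the gap until `i` has slewed over it
          (∀ t ∈ Icc t₁ t₂, a j t = 0 ∧ P i ∩ P j ⊆ lightRay E (p j) (θ' j t)) ∧
          P i ∩ P j ⊆ (S i).swept (p i) (P i) (a i t₂) ∧
          -- then both agents concurrently sweep the remainder of their cells
          (a i t₂ < (S i).width → StrictMonoOn (a i) (Icc t₂ t₃)) ∧
          StrictMonoOn (a j) (Icc t₂ t₃) ∧
          a i t₃ = (S i).width ∧ a j t₃ = (S j).width ∧
          -- the clear region grows with the sweep and finally contains both cells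
          (∀ t ∈ Icc t₀ t₃,
            IsClear E p θ' t (D ∪ sweptRegion P p S (fun k => τ k ≤ t) (fun k => a k t))) ∧
          IsClear E p θ' t₃ (D ∪ P i ∪ P j)) := by
  refine ⟨hp.exists_isSweepPlan hP, fun S hS => ⟨?_, ?_⟩⟩
  · intro t₀ t₁ θ τ a D ht₀ _ hθ h _ hclear hsub hbd t ht
    exact h.isClear_union hE hP hp hS ht₀ hθ hclear hsub hbd ht
  intro t₀ θ on a₀' D ht₀ hθ haim' hco' hi hrel' hj _ hclear hsub' hbd'
  classical
  -- agents that are not engaged have turned through no angle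
  obtain ⟨a₀, ha₀, ha₀'⟩ : ∃ a₀ : ι → ℝ, (∀ k, ¬ on k → a₀ k = 0) ∧ ∀ k, on k → a₀' k = a₀ k :=
    ⟨fun k => if on k then a₀' k else 0, fun k hk => if_neg hk, fun k hk => (if_pos hk).symm⟩
  have haim : ∀ k, on k → θ k t₀ = (S k).angle (a₀ k) := fun k hk => by
    rw [haim' k hk, ha₀' k hk]
  have hco := hco'.congr ha₀'
  have hrel := hrel'.congr ha₀'
  rw [sweptRegion_congr (fun _ => Iff.rfl) ha₀'] at hsub' hbd'
  have haj := ha₀ j hj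
  have hwj : 0 < (S j).width := (hS.1 j).2.1
  obtain ⟨b, hb, hgap⟩ := (hS.1 i).exists_subset_swept
    (inter_subset_left : P i ∩ P j ⊆ P i) (hco.range i hi)
  set a := expansionAngle S i j a₀ b t₀ with ha_def
  set τ := expansionStart P root i j on t₀ with hτ_def
  have hmono : ∀ k, Monotone (a k) := monotone_expansionAngle hb hwj
  have hinit : ∀ k, ∀ t ≤ t₀ + 1, a k t = a₀ k :=
    fun k t ht => expansionAngle_of_le haj ht k
  have hinit₀ : ∀ k, a k t₀ = a₀ k := fun k => hinit k t₀ (by linarith)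
  have hai₂ : a i (t₀ + 2) = b := by
    rw [ha_def, expansionAngle_left le_rfl, ramp_of_nonpos (by linarith)]
    ring
  have hai₃ : a i (t₀ + 3) = (S i).width := by
    rw [ha_def, expansionAngle_left (by linarith), ramp_of_one_le (by linarith)]
    ring
  have haj₃ : a j (t₀ + 3) = (S j).width := by
    rw [ha_def, expansionAngle_right hij.ne, ramp_of_one_le (by linarith), mul_one]
  have hτj : τ j ≤ t₀ + 1 := expansionStart_of_child (Or.inl hij)
  have hτi : τ i = t₀ := expansionStart_of_on hi
  obtain ⟨θ', hθ'c, hθ'0, hθ'on, hθ'next, hθ'rest⟩ := exists_continuation S hθ on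
    (fun k => IsParent P root i k ∨ IsParent P root j k) (a := a) continuous_expansionAngle
    (fun k t ht => by rw [hinit k t (by linarith), hinit₀]) (fun k hk => by
      rw [hinit₀, ha₀ k hk]) ht₀ (fun k hk => by rw [hinit₀]; exact haim k hk)
  -- These agents keep their directions, so the boundary points of `D` that they light at `t₀`
  -- remain lit.
  have hfix : ∀ k, k ≠ i → k ≠ j → ¬ IsParent P root i k → ¬ IsParent P root j k →
      ∀ t ∈ Icc t₀ (t₀ + 3), θ' k t = θ k t₀ := by
    intro k hki hkj hik hjk t ht
    by_cases hk : on k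
    · rw [hθ'on k hk t ht.1, haim k hk, ha_def, expansionAngle_other hki hkj]
    · exact hθ'rest k hk (not_or.2 ⟨hik, hjk⟩) t ht.1
  have hsweep : IsSweeping P root p S t₀ (t₀ + 3) θ' τ a := by
    refine ⟨fun k t ht hk => ?_, fun k s _ t _ _ hst => hmono k hst, fun k hk hk3 => ?_,
      fun t ht => coordinated_expansion hP.tree hS hij ha₀ hco hi hrel hj hb hgap ht.1⟩
    · rcases expansionStart_cases (P := P) (root := root) (i := i) (j := j) (on := on)
        (t₀ := t₀) k with ⟨h, he⟩ | ⟨h, h', he⟩ | ⟨-, -, he⟩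
      · exact hθ'on k h t ht.1
      · exact hθ'next k h h' t (he ▸ hk)
      · rw [hτ_def, he] at hk
        linarith [ht.2]
    · rcases expansionStart_cases (P := P) (root := root) (i := i) (j := j) (on := on)
        (t₀ := t₀) k with ⟨-, he⟩ | ⟨h, -, he⟩ | ⟨-, -, he⟩
      · exact absurd (he ▸ hk) (lt_irrefl t₀)
      · rw [hinit k _ he.le, ha₀ k h]
      -- The start time `t₀ + 4` lies beyond the end `t₀ + 3`: these agents never become engaged.
      · rw [hτ_def, he] at hk3
        linarith
  have hregion : sweptRegion P p S (fun k => τ k ≤ t₀) (fun k => a k t₀) =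
      sweptRegion P p S on a₀ :=
    sweptRegion_congr expansionStart_le_iff fun k _ => hinit₀ k
  have hgrow : ∀ t ∈ Icc t₀ (t₀ + 3),
      IsClear E p θ' t (D ∪ sweptRegion P p S (fun k => τ k ≤ t) (fun k => a k t)) := by
    intro t ht
    refine hsweep.isClear_union hE hP hp hS ht₀ (fun k => hθ'c k _)
      (fun x hx hcon => hclear x hx (hcon.congr (fun k s hs => hθ'0 k s hs.2) le_rfl))
      (hregion ▸ hsub') ?_ ht
    rw [hregion]
    refine hbd'.trans (union_subset_union_right _ ?_)
    rintro x ⟨k, hki, hkj, hik, hjk, hx⟩ s hs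
    exact ⟨k, by rwa [hfix k hki hkj hik hjk s hs]⟩
  refine ⟨t₀ + 1, t₀ + 2, t₀ + 3, θ', τ, a, by linarith, by linarith, by linarith,
    fun k => hθ'c k _, fun k t ht => hθ'0 k t ht.2, expansionStart_le_iff,
    fun k hk => by rw [hinit₀, ha₀' k hk], hsweep, ?_, hfix, ?_, ?_, hτj, ?_, ?_, ?_, ?_,
    hai₃, haj₃, hgrow, ?_⟩
  · intro k hki hkj t _ _
    rw [ha_def, expansionAngle_other hki hkj, expansionAngle_other hki hkj]
  · intro t ht
    rw [hinit i t ht.2, ha₀' i hi]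
  · rw [hinit i _ le_rfl]
    -- Had `i` begun to slew over the gap, coordination would have `j` engaged at `t₀`.
    exact fun hbeg => hj (hco.child_aimed i j hij hi hbeg)
  · intro t ht
    have h0 : a j t = 0 := by
      rw [ha_def, expansionAngle_right hij.ne, ramp_of_nonpos (by linarith [ht.2]), mul_zero]
    refine ⟨h0, fun x hx => ?_⟩
    obtain ⟨r, hr, he⟩ := hS.2 i j hij x hx
    rw [hsweep.aim j t ⟨by linarith [ht.1], by linarith [ht.2]⟩ (hτj.trans ht.1), h0]
    exact mem_lightRay_of_mem_cell hP hp hx.2 hr he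
  · rwa [hai₂]
  · intro hlt s hs t ht hst
    rw [hai₂] at hlt
    rw [ha_def, expansionAngle_left hs.1, expansionAngle_left ht.1]
    have h := ramp_strictMonoOn (t₀ + 2) ⟨hs.1, by linarith [hs.2]⟩ ⟨ht.1, by linarith [ht.2]⟩ hst
    exact add_lt_add_right (mul_lt_mul_of_pos_left h (sub_pos.2 hlt)) _
  · intro s hs t ht hst
    rw [ha_def, expansionAngle_right hij.ne, expansionAngle_right hij.ne]
    have h := ramp_strictMonoOn (t₀ + 2) ⟨hs.1, by linarith [hs.2]⟩ ⟨ht.1, by linarith [ht.2]⟩ hst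
    exact mul_lt_mul_of_pos_left h hwj
  · have hcells : ∀ k, τ k ≤ t₀ + 3 → a k (t₀ + 3) = (S k).width →
        P k ⊆ sweptRegion P p S (fun k => τ k ≤ t₀ + 3) (fun k => a k (t₀ + 3)) := by
      intro k hk hak x hx
      refine ⟨k, hk, ?_⟩
      simp only
      rw [hak, (hS.1 k).swept_width]
      exact hx
    intro x hx
    refine hgrow (t₀ + 3) ⟨by linarith, le_rfl⟩ x ?_
    rcases hx with (hx | hx) | hx
    · exact Or.inl hx
    · exact Or.inr (hcells i (by linarith) hai₃ hx)
    · exact Or.inr (hcells j (by linarith) haj₃ hx)
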